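/- **Setting.** Let $d\ge 2$ and let $\Omega\subset\mathbb R^d$ be a bounded polyhedral domain, i.e. the connected non-empty interior of a finite union of convex polytopes, such that every point of $\partial\Omega$ has arbitrarily small open neighbourhoods $U$ with $U\cap\Omega$ connected (this holds for every Lipschitz domain). Functions are complex valued. For $U\subset\Omega$ open, $\|u\|_{0,U}^2=\int_U|u|^2$, $\|u\|_{1,U}^2=\int_U(|u|^2+\sum_i|\partial_iu|^2)$, and $H^1_0(U)$ is the closure of $C_c^\infty(U)$ in $H^1(U)$. $H^{-1}(\Omega)$ is the space of bounded antilinear functionals on $H^1_0(\Omega)$, and for $f\in H^{-1}(\Omega)$ $$\|f\|_{-1,U}=\sup\{|f(\phi)| : \phi\in H^1_0(U),\ \|\phi\|_{1,U}=1\}$$ ($\phi$ extended by zero to $\Omega$). For sets $D\subset U\subset\Omega$, write $D\subset\subset U$ if $\operatorname{dist}(\partial D\setminus\partial\Omega,\ \partial U\setminus\partial\Omega)>0$ (the distance to the empty set being $+\infty$). The support of a function on $\Omega$ is its support relative to $\Omega$. For $U\subset\Omega$ open, let $$a_U(u,v)=\int_U\Big(\sum_{i,j}a_{ij}\,\partial_iu\,\overline{\partial_jv}+\sum_ib_i\,\partial_iu\,\overline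 v+c\,u\,\overline v\Big)dx,$$ with complex coefficients $a_{ij},b_i\in W_{1,\infty}(\Omega)$, $c\in L_\infty(\Omega)$, and let $a_0>0$ be such that $\operatorname{Re}\sum_{i,j}a_{ij}(x)\xi_i\xi_j\ge a_0\sum_i\xi_i^2$ for almost every $x\in\Omega$ and all $\xi\in\mathbb R^d$, and $\operatorname{Re}a_\Omega(u,u)\ge\frac12a_0\|u\|_{1,\Omega}^2$ for all $u\in H^1(\Omega)$. A mesh of $\Omega$ consists of finitely many compact elements with non-empty, pairwise disjoint interiors and null boundaries, covering $\overline\Omega$. Consider a family of meshes of $\Omega$, indexed by $h$, with mesh-size function $h(x)$ (the diameter of the element containing $x$) and mesh diameter $h(\Omega)=\max_{x\in\Omega} h(x)$, and for each of them a complex linear space $V_h(\Omega)\subset C(\overline\Omega)$ of piecewise polynomials on the mesh. For $U\subset\Omega$ open, let $V_h(U)$ be the space of restrictions to $\overline U$ of functions in $V_h(\Omega)$, and $V_0^h(U)=\{v\in V_h(\Omega)\cap H_0^1(\Omega):\operatorname{supp}v\subset\subset U\}$. Let $G,\Omega_0$ be open with $G\subset\subset\Omega_0\subset\Omega$. Assume,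 with constants independent of the member of the family: * (Grading) there are $\nu\ge1$ and $C$ with $h(\Omega)^\nu\le C\,h(x)$ for all $x\in\Omega$; * (Inverse estimate) $\|v\|_{1,\Omega_0}\le C\|h^{-1}v\|_{0,\Omega_0}$ for all $v\in V_h(\Omega_0)$; * (Superapproximation) for every open $D\subset\Omega_0$ and every real-valued $\omega\in C^\infty(\overline\Omega)$ (the restriction of a smooth function on $\mathbb R^d$) with $\operatorname{supp}\omega\subset\subset D$ there is $C=C(D,\omega)$ such that for every $w\in V_h(D)$ with $w=0$ on $\partial D\cap\partial\Omega$ there is $v\in V_0^h(D)$ with $\|h^{-1}(\omega w-v)\|_{1,D}\le C\|w\|_{1,D}$, where $\|h^{-1}u\|_{1,D}^2=\int_Dh(x)^{-2}(|u|^2+\sum_i|\partial_iu|^2)\,dx$. **Lemma 2.3.** There is a constant $C>0$, independent of the member of the family (and of $f$ and $w$ below), such that the following holds for every member of the family. If $f\in H^{-1}(\Omega)$ and $w\in V_h(\Omega_0)$ vanishes on $\partial\Omega\cap\partial\Omega_0$ and satisfies $$a_{\Omega_0}(w,v)=f(v)\qquad\forall v\in V_0^h(\Omega_0),$$ then $$\|w\|_{1,G}\le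 C\big(\|w\|_{0,\Omega_0}+\|f\|_{-1,\Omega_0}\big).$$ -/

import Mathlib

open MeasureTheory
open scoped ContDiff ComplexConjugate

noncomputable section

namespace LocalFEM

/-- `ℝ^d` with the Euclidean norm. -/
abbrev E (d : ℕ) : Type := EuclideanSpace ℝ (Fin d)

variable {d : ℕ}

/-! ### Sobolev spaces of complex-valued functions

A function on an open set `U` is represented by a function on `ℝ^d`; its values off `U` play no role. -/

/-- The classical partial derivative `∂ᵢ φ`. -/
def partialDeriv (i : Fin d) (φ : E d → ℂ) (x : E d) : ℂ :=
  fderiv ℝ φ x (EuclideanSpace.single i 1)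

/-- `φ ∈ C_c^∞(U)`. -/
def IsTestFun (U : Set (E d)) (φ : E d → ℂ) : Prop :=
  ContDiff ℝ ∞ φ ∧ HasCompactSupport φ ∧ tsupport φ ⊆ U

/-- `g` is a weak derivative `∂ᵢ u` on `U`. -/
def HasWeakDeriv (U : Set (E d)) (i : Fin d) (u g : E d → ℂ) : Prop :=
  LocallyIntegrableOn u U ∧ LocallyIntegrableOn g U ∧
    ∀ φ : E d → ℂ, IsTestFun U φ →
      ∫ x in U, u x * partialDeriv i φ x = -∫ x in U, g x * φ x

open Classical in
/-- The weak derivative `∂ᵢ u` on `U` (unique almost everywhere on the open set `U`; it is `0` by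
convention if there is none). -/
def weakDeriv (U : Set (E d)) (i : Fin d) (u : E d → ℂ) : E d → ℂ :=
  if h : ∃ g, HasWeakDeriv U i u g then h.choose else 0

/-- `u ∈ L_∞(U)`. -/
def MemLinfty (U : Set (E d)) (u : E d → ℂ) : Prop :=
  MemLp u ⊤ (volume.restrict U)

/-- `u ∈ W_{1,∞}(U)`. -/
def MemW1infty (U : Set (E d)) (u : E d → ℂ) : Prop :=
  MemLinfty U u ∧ ∀ i, ∃ g, MemLinfty U g ∧ HasWeakDeriv U i u g

/-- `u ∈ H^1(U)`. -/
def MemH1 (U : Set (E d)) (u : E d → ℂ) : Prop :=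
  MemLp u 2 (volume.restrict U) ∧
    ∀ i, ∃ g, MemLp g 2 (volume.restrict U) ∧ HasWeakDeriv U i u g

/-- The weighted norm `‖ρ u‖_{0,U}`. -/
def wnorm0 (U : Set (E d)) (ρ : E d → ℝ) (u : E d → ℂ) : ℝ :=
  Real.sqrt (∫ x in U, ρ x ^ 2 * ‖u x‖ ^ 2)

/-- The weighted norm `‖ρ u‖_{1,U}`, where the weight `ρ` (a function that is constant on each
element of a mesh) is not differentiated:
`‖ρ u‖_{1,U}² = ∫_U ρ² (|u|² + ∑ᵢ |∂ᵢ u|²)`. -/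
def wnorm1 (U : Set (E d)) (ρ : E d → ℝ) (u : E d → ℂ) : ℝ :=
  Real.sqrt (∫ x in U, ρ x ^ 2 * (‖u x‖ ^ 2 + ∑ i, ‖weakDeriv U i u x‖ ^ 2))

/-- `‖u‖_{0,U}`. -/
def norm0 (U : Set (E d)) (u : E d → ℂ) : ℝ := wnorm0 U (fun _ => 1) u

/-- `‖u‖_{1,U}`. -/
def norm1 (U : Set (E d)) (u : E d → ℂ) : ℝ := wnorm1 U (fun _ => 1) u

/-- `u ∈ H^1_0(U)`, the closure of `C_c^∞(U)` in `H^1(U)`. -/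
def MemH10 (U : Set (E d)) (u : E d → ℂ) : Prop :=
  MemH1 U u ∧ ∀ ε > 0, ∃ φ, IsTestFun U φ ∧ norm1 U (u - φ) < ε

/-- `f ∈ H^{-1}(Ω)`: a bounded functional on `H^1_0(Ω)`, antilinear because the sesquilinear form
below is antilinear in its second argument. Only the values of `f` on `H^1_0(Ω)` matter. -/
def MemHneg1 (Ω : Set (E d)) (f : (E d → ℂ) → ℂ) : Prop :=
  (∀ u v, MemH10 Ω u → MemH10 Ω v → f (u + v) = f u + f v) ∧
  (∀ (z : ℂ) (u), MemH10 Ω u → f (z • u) = conj z * f u) ∧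
  ∃ K : ℝ, ∀ u, MemH10 Ω u → ‖f u‖ ≤ K * norm1 Ω u

/-- `‖f‖_{-1,U}`, the supremum of `|f(φ)|` over `φ ∈ H^1_0(U)` with `‖φ‖_{1,U} = 1`; here `φ` is
extended by zero outside `U`, which makes it an element of `H^1_0(Ω)` for `U ⊆ Ω`. -/
def normNeg1 (U : Set (E d)) (f : (E d → ℂ) → ℂ) : ℝ :=
  sSup {r : ℝ | ∃ φ, MemH10 U φ ∧ norm1 U φ = 1 ∧ r = ‖f (U.indicator φ)‖}

/-! ### Domains -/

/-- A bounded polyhedral domain: the connected (non-empty) interior of a finite union of convex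
polytopes, which does not touch itself along its boundary, that is, each boundary point has
arbitrarily small neighbourhoods whose intersection with `Ω` is connected. The last condition
holds for every Lipschitz domain. -/
def IsPolyhedralDomain (Ω : Set (E d)) : Prop :=
  IsConnected Ω ∧
  (∃ K : Finset (Finset (E d)), Ω = interior (⋃ s ∈ K, convexHull ℝ (s : Set (E d)))) ∧
  ∀ x ∈ frontier Ω, ∀ ε > 0, ∃ U : Set (E d),
    IsOpen U ∧ x ∈ U ∧ U ⊆ Metric.ball x ε ∧ IsConnected (U ∩ Ω)

/-- `D ⊂⊂ U` for `D ⊆ U ⊆ Ω`: `dist(∂D \ ∂Ω, ∂U \ ∂Ω) > 0`, where the distance to the empty set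
is infinite. -/
def WellInside (Ω D U : Set (E d)) : Prop :=
  D ⊆ U ∧ U ⊆ Ω ∧
    ∃ δ > 0, ∀ x ∈ frontier D \ frontier Ω, ∀ y ∈ frontier U \ frontier Ω, δ ≤ dist x y

/-- The support in `Ω` of a function on `Ω`. -/
def suppIn {F : Type*} [Zero F] (Ω : Set (E d)) (v : E d → F) : Set (E d) :=
  Ω ∩ closure {x | x ∈ Ω ∧ v x ≠ 0}

/-! ### The sesquilinear form -/

/-- The coefficients `a_{ij}`, `b_i`, `c` of the operator
`L u = -∑ ∂_j (a_{ij} ∂_i u) + ∑ b_i ∂_i u + c u`. -/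
structure Coeffs (d : ℕ) where
  a : Fin d → Fin d → E d → ℂ
  b : Fin d → E d → ℂ
  c : E d → ℂ

/-- `a(u,v) = ∫_U (∑ a_{ij} ∂_i u conj(∂_j v) + ∑ b_i ∂_i u conj(v) + c u conj(v))`. -/
def Coeffs.form (L : Coeffs d) (U : Set (E d)) (u v : E d → ℂ) : ℂ :=
  ∫ x in U, ((∑ i, ∑ j, L.a i j x * weakDeriv U i u x * conj (weakDeriv U j v x))
    + (∑ i, L.b i x * weakDeriv U i u x * conj (v x)) + L.c x * u x * conj (v x))

/-- The assumptions on the coefficients: regularity, uniform strong ellipticity with constant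
`a₀ > 0`, and coercivity of the form, `Re a(u,u) ≥ (a₀/2) ‖u‖²_{1,Ω}` on `H^1(Ω)`. -/
structure Coeffs.Admissible (L : Coeffs d) (Ω : Set (E d)) (a₀ : ℝ) : Prop where
  pos : 0 < a₀
  mem_a : ∀ i j, MemW1infty Ω (L.a i j)
  mem_b : ∀ i, MemW1infty Ω (L.b i)
  mem_c : MemLinfty Ω L.c
  elliptic : ∀ᵐ x ∂(volume.restrict Ω), ∀ ξ : Fin d → ℝ,
    a₀ * ∑ i, ξ i ^ 2 ≤ (∑ i, ∑ j, L.a i j x * (ξ i : ℂ) * (ξ j : ℂ)).re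
  coercive : ∀ u, MemH1 Ω u → a₀ / 2 * norm1 Ω u ^ 2 ≤ (L.form Ω u u).re

/-! ### Meshes and finite element spaces -/

/-- A mesh of `Ω`: finitely many compact elements with non-empty, pairwise disjoint interiors and
boundaries of measure zero, which cover the closure of `Ω`. -/
structure Mesh (Ω : Set (E d)) where
  elems : Finset (Set (E d))
  isCompact : ∀ τ ∈ elems, IsCompact τ
  interior_nonempty : ∀ τ ∈ elems, (interior τ).Nonempty
  frontier_null : ∀ τ ∈ elems, volume (frontier τ) = 0
  disjoint : ∀ τ ∈ elems, ∀ σ ∈ elems, τ ≠ σ → Disjoint (interior τ) (interior σ)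
  cover : ⋃ τ ∈ elems, τ = closure Ω

/-- The mesh-size function `h(x)`: the diameter of the element that contains `x` (of the largest
one if `x` lies in several elements, which happens only on a null set). -/
def Mesh.size {Ω : Set (E d)} (T : Mesh Ω) (x : E d) : ℝ :=
  sSup (Metric.diam '' {τ | τ ∈ T.elems ∧ x ∈ τ})

/-- The mesh diameter `h(Ω) = max_{x ∈ Ω} h(x)`. -/
def Mesh.maxSize {Ω : Set (E d)} (T : Mesh Ω) : ℝ := sSup (T.size '' Ω)

/-- `V = V_h(Ω) ⊆ C(closure Ω)` is a space of piecewise polynomials on the mesh. -/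
def IsFESpace {Ω : Set (E d)} (T : Mesh Ω) (V : Submodule ℂ (E d → ℂ)) : Prop :=
  ∀ v ∈ V, ContinuousOn v (closure Ω) ∧
    ∀ τ ∈ T.elems, ∃ p : MvPolynomial (Fin d) ℂ,
      ∀ x ∈ τ, v x = MvPolynomial.eval (fun i => ((x i : ℝ) : ℂ)) p

/-- `V_h(G)`: the restrictions to (the closure of) `G` of the functions in `V_h(Ω)`. -/
def restr (V : Submodule ℂ (E d → ℂ)) (G : Set (E d)) : Set (E d → ℂ) :=
  {w | ∃ W ∈ V, Set.EqOn w W (closure G)}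

/-- The functions in `V_h^0(Ω) = V_h(Ω) ∩ H^1_0(Ω)` with support well inside `G`. -/
def innerSpace (Ω : Set (E d)) (V : Submodule ℂ (E d → ℂ)) (G : Set (E d)) : Set (E d → ℂ) :=
  {v | v ∈ V ∧ MemH10 Ω v ∧ WellInside Ω (suppIn Ω v) G}

variable {ι : Type*} {Ω : Set (E d)}

/-- Mesh grading, uniformly in the family: `h(Ω)^ν ≲ h(x)` on `Ω` for some `ν ≥ 1`. -/
def MeshGrading (T : ι → Mesh Ω) : Prop :=
  ∃ ν : ℝ, 1 ≤ ν ∧ ∃ C : ℝ, 0 < C ∧ ∀ k, ∀ x ∈ Ω, (T k).maxSize ^ ν ≤ C * (T k).size x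

/-- Inverse estimate, uniformly in the family: `‖v‖_{1,Ω₀} ≲ ‖h⁻¹ v‖_{0,Ω₀}` on `V_h(Ω₀)`. -/
def InverseEstimate (T : ι → Mesh Ω) (V : ι → Submodule ℂ (E d → ℂ)) (Ω₀ : Set (E d)) : Prop :=
  ∃ C : ℝ, 0 < C ∧ ∀ k, ∀ v ∈ restr (V k) Ω₀,
    norm1 Ω₀ v ≤ C * wnorm0 Ω₀ (fun x => ((T k).size x)⁻¹) v

/-- Superapproximation, uniformly in the family: for open `G ⊆ Ω₀` and `η ∈ C^∞(closure Ω)` (the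
restriction of a smooth function on `ℝ^d`) with `supp η ⊂⊂ G`, each `w ∈ V_h(G)` that vanishes on
`∂G ∩ ∂Ω` admits a `v` in the finite element space, in `H^1_0(Ω)` and supported well inside `G`,
with `‖h⁻¹ (η w - v)‖_{1,G} ≲ ‖w‖_{1,G}`. -/
def Superapproximation (T : ι → Mesh Ω) (V : ι → Submodule ℂ (E d → ℂ)) (Ω₀ : Set (E d)) :
    Prop :=
  ∀ G : Set (E d), IsOpen G → G ⊆ Ω₀ →
    ∀ η : E d → ℝ, ContDiff ℝ ∞ η → WellInside Ω (suppIn Ω η) G →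
      ∃ C : ℝ, 0 < C ∧ ∀ k, ∀ w ∈ restr (V k) G, (∀ x ∈ frontier G ∩ frontier Ω, w x = 0) →
        ∃ v ∈ innerSpace Ω (V k) G,
          wnorm1 G (fun x => ((T k).size x)⁻¹) (fun x => (η x : ℂ) * w x - v x)
            ≤ C * norm1 G w

end LocalFEM

end

open LocalFEM

/-! The argument is Caccioppoli's inequality in discrete form, iterated until the mesh size beats
the inverse estimate. Let `η` be a cut-off around `G`. Coercivity is applied to `η w`, and `a(ηw,
ηw)` differs from `a(w, η²w)` only by terms in which a derivative falls on `η`; these are absorbed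
into `‖ηw‖₁²` at the price of `‖w‖₀²`. As `η²w` is not in the finite element space, it is replaced
by its superapproximant `v`: `a(w, v) = f(v)` is bounded by `‖f‖₋₁ ‖v‖₁`, and `‖η²w - v‖₁ ≤ C h
‖w‖₁`. The outcome, in squared norms with `h = h(Ω)`, is that the energy on a neighbourhood of `G`
is at most `C (h ‖w‖₁² + ‖w‖₀² + ‖f‖₋₁²)`, with the energy on the right taken over a slightly larger
neighbourhood (`Coeffs.Admissible.local_energy`, `interior_estimate_step`).

On nested neighbourhoods, `n` such steps produce the factor `hⁿ` in front of `‖w‖₁²` on `Ω₀`. The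
inverse estimate and the grading bound `‖w‖₁` by `C h^{-ν} ‖w‖₀`, so `n ≥ 2ν` steps suffice
(`interior_estimate_pow`, `interior_estimate`).

The neighbourhoods are `Ω ∩ thickening s G`. They stay inside `Ω₀` for small `s` because `Ω` does
not touch itself along its boundary (`WellInside.exists_thickening_subset`). The cut-offs need not
vanish on `∂Ω`, so the estimate reaches up to the boundary.

Since weak derivatives and real integrals have default values, regularity must be established first:
finite element functions are in `H¹(Ω)` (`IsFESpace.hasGrad`), and `v` is in `H¹₀(Ω₀)`, which bounds
`f(v)` by the local dual norm (`MemH10.of_cutoff`, `MemHneg1.norm_le`). -/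

noncomputable section

namespace LocalFEM

/-! ### Calculus of weak derivatives. -/

section WeakDerivatives

variable {d : ℕ} {U U' Ω : Set (E d)} {i : Fin d} {u v g g' : E d → ℂ} {φ : E d → ℂ}

namespace IsTestFun

lemma continuous (h : IsTestFun U φ) : Continuous φ := h.1.continuous

lemma mono (h : IsTestFun U φ) (hU : U ⊆ U') : IsTestFun U' φ := ⟨h.1, h.2.1, h.2.2.trans hU⟩

lemma zero_of_notMem (h : IsTestFun U φ) {x : E d} (hx : x ∉ U) : φ x = 0 :=
  image_eq_zero_of_notMem_tsupport fun hx' => hx (h.2.2 hx')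

lemma partialDeriv (h : IsTestFun U φ) (i : Fin d) : IsTestFun U (partialDeriv i φ) := by
  refine ⟨?_, h.2.1.fderiv_apply _ _, (tsupport_fderiv_apply_subset ℝ _).trans h.2.2⟩
  have : ContDiff ℝ ∞ (fderiv ℝ φ) := h.1.fderiv_right (by simp)
  exact this.clm_apply contDiff_const

lemma ofReal_mul (h : IsTestFun U φ) {η : E d → ℝ} (hη : ContDiff ℝ ∞ η) :
    IsTestFun U (fun x => (η x : ℂ) * φ x) := by
  refine ⟨(Complex.ofRealCLM.contDiff.comp hη).mul h.1, h.2.1.mul_left, ?_⟩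
  exact (closure_mono (Function.support_mul_subset_right _ _)).trans h.2.2

lemma zero : IsTestFun U (0 : E d → ℂ) :=
  ⟨contDiff_const, HasCompactSupport.zero, by simp [tsupport]⟩

lemma memLp (h : IsTestFun U φ) (p : ENNReal) (μ : Measure (E d)) [IsFiniteMeasureOnCompacts μ] :
    MemLp φ p μ := h.continuous.memLp_of_hasCompactSupport h.2.1

lemma hasWeakDeriv (h : IsTestFun U φ) (i : Fin d) :
    HasWeakDeriv U i φ (LocalFEM.partialDeriv i φ) := by
  refine ⟨h.continuous.locallyIntegrable.locallyIntegrableOn _,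
    (h.partialDeriv i).continuous.locallyIntegrable.locallyIntegrableOn _, fun ψ hψ => ?_⟩
  rw [setIntegral_eq_integral_of_forall_compl_eq_zero, setIntegral_eq_integral_of_forall_compl_eq_zero]
  · refine integral_mul_fderiv_eq_neg_fderiv_mul_of_integrable (𝕜 := ℂ) ?_ ?_ ?_
      (fun x _ => h.1.differentiable (by simp) x) (fun x _ => hψ.1.differentiable (by simp) x)
    · exact ((h.partialDeriv i).continuous.mul hψ.continuous).integrable_of_hasCompactSupport
        hψ.2.1.mul_left
    · exact (h.continuous.mul (hψ.partialDeriv i).continuous).integrable_of_hasCompactSupport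
        h.2.1.mul_right
    · exact (h.continuous.mul hψ.continuous).integrable_of_hasCompactSupport hψ.2.1.mul_left
  · intro x hx; simp [hψ.zero_of_notMem hx]
  · intro x hx; simp [h.zero_of_notMem hx]

end IsTestFun

lemma integrableOn_mul_testFun (hg : LocallyIntegrableOn g U) (hφ : IsTestFun U φ) :
    IntegrableOn (fun x => g x * φ x) U := by
  have h1 : IntegrableOn g (tsupport φ) := hg.integrableOn_compact_subset hφ.2.2 hφ.2.1
  have h2 : IntegrableOn (fun x => g x * φ x) (tsupport φ) :=
    h1.mul_continuousOn hφ.continuous.continuousOn hφ.2.1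
  refine ((integrableOn_iff_integrable_of_support_subset ?_).1 h2).integrableOn
  intro x hx
  refine subset_tsupport _ ?_
  intro h0
  simp [h0] at hx

lemma ae_restrict_of_subset {p : E d → Prop} (h : ∀ᵐ x ∂volume.restrict U', p x) (hU : U ⊆ U') :
    ∀ᵐ x ∂volume.restrict U, p x :=
  ae_mono (Measure.restrict_mono hU le_rfl) h

namespace HasWeakDeriv

lemma unique (hU : IsOpen U) (h : HasWeakDeriv U i u g) (h' : HasWeakDeriv U i u g') :
    g =ᵐ[volume.restrict U] g' := by
  have := hU.ae_eq_zero_of_integral_contDiff_smul_eq_zero (h.2.1.sub h'.2.1) ?_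
  · refine (ae_restrict_iff' hU.measurableSet).2 ?_
    filter_upwards [this] with x hx hxU
    exact sub_eq_zero.1 (hx hxU)
  · intro ψ hψ hc hs
    have ht : IsTestFun U (fun x => (ψ x : ℂ)) := by
      refine ⟨Complex.ofRealCLM.contDiff.comp hψ, hc.comp_left Complex.ofReal_zero, ?_⟩
      refine (closure_mono ?_).trans hs
      intro x hx h0
      simp [h0] at hx
    have e1 := h.2.2 _ ht
    have e2 := h'.2.2 _ ht
    have e3 : ∫ x in U, (g x - g' x) * (ψ x : ℂ) = 0 := by
      simp_rw [sub_mul]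
      rw [integral_sub (integrableOn_mul_testFun h.2.1 ht) (integrableOn_mul_testFun h'.2.1 ht)]
      have : ∫ x in U, g x * (ψ x : ℂ) = ∫ x in U, g' x * (ψ x : ℂ) :=
        neg_injective (e1.symm.trans e2)
      rw [this, sub_self]
    rw [setIntegral_eq_integral_of_forall_compl_eq_zero] at e3
    · rw [← e3]
      refine integral_congr_ae (Filter.Eventually.of_forall fun x => ?_)
      simp [mul_comm]
    · intro x hx
      simp [show (ψ x : ℂ) = 0 from ht.zero_of_notMem hx]

lemma weakDeriv_ae_eq (hU : IsOpen U) (h : HasWeakDeriv U i u g) :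
    weakDeriv U i u =ᵐ[volume.restrict U] g := by
  have hex : ∃ g, HasWeakDeriv U i u g := ⟨g, h⟩
  rw [weakDeriv, dif_pos hex]
  exact unique hU hex.choose_spec h

lemma mono (h : HasWeakDeriv U' i u g) (hU : U ⊆ U') :
    HasWeakDeriv U i u g := by
  refine ⟨h.1.mono_set hU, h.2.1.mono_set hU, fun φ hφ => ?_⟩
  have := h.2.2 φ (hφ.mono hU)
  have e : ∀ {S : Set (E d)} (w : E d → ℂ) {ψ : E d → ℂ}, IsTestFun S ψ →
      ∫ x in S, w x * ψ x = ∫ x, w x * ψ x := fun w ψ hψ =>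
    setIntegral_eq_integral_of_forall_compl_eq_zero fun x hx => by
      rw [hψ.zero_of_notMem hx, mul_zero]
  rw [e u ((hφ.mono hU).partialDeriv i), e g (hφ.mono hU)] at this
  rwa [e u (hφ.partialDeriv i), e g hφ]

lemma congr (h : HasWeakDeriv U i u g) (hu : u =ᵐ[volume.restrict U] v)
    (hg : g =ᵐ[volume.restrict U] g') : HasWeakDeriv U i v g' := by
  refine ⟨h.1.congr hu, h.2.1.congr hg, fun φ hφ => ?_⟩
  have := h.2.2 φ hφ
  rw [integral_congr_ae (f := fun x => u x * LocalFEM.partialDeriv i φ x) (g := fun x => v x * LocalFEM.partialDeriv i φ x)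
      (by filter_upwards [hu] with x hx; simp [hx]),
    integral_congr_ae (f := fun x => g x * φ x) (g := fun x => g' x * φ x)
      (by filter_upwards [hg] with x hx; simp [hx])] at this
  exact this

lemma add (h : HasWeakDeriv U i u g) (h' : HasWeakDeriv U i v g') :
    HasWeakDeriv U i (u + v) (g + g') := by
  refine ⟨h.1.add h'.1, h.2.1.add h'.2.1, fun φ hφ => ?_⟩
  simp only [Pi.add_apply, add_mul]
  rw [integral_add (integrableOn_mul_testFun h.1 (hφ.partialDeriv i))
      (integrableOn_mul_testFun h'.1 (hφ.partialDeriv i)),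
    integral_add (integrableOn_mul_testFun h.2.1 hφ)
      (integrableOn_mul_testFun h'.2.1 hφ), h.2.2 φ hφ, h'.2.2 φ hφ]
  ring

lemma const_smul (h : HasWeakDeriv U i u g) (z : ℂ) :
    HasWeakDeriv U i (z • u) (z • g) := by
  refine ⟨h.1.smul z, h.2.1.smul z, fun φ hφ => ?_⟩
  simp only [Pi.smul_apply, smul_eq_mul, mul_assoc]
  rw [integral_const_mul, integral_const_mul, h.2.2 φ hφ, mul_neg]

lemma sub (h : HasWeakDeriv U i u g) (h' : HasWeakDeriv U i v g') :
    HasWeakDeriv U i (u - v) (g - g') := by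
  have := h.add (h'.const_smul (-1))
  simpa [sub_eq_add_neg] using this

lemma ofReal_mul (hU : IsOpen U) (h : HasWeakDeriv U i u g) {η : E d → ℝ}
    (hη : ContDiff ℝ ∞ η) :
    HasWeakDeriv U i (fun x => (η x : ℂ) * u x)
      (fun x => (η x : ℂ) * g x + (fderiv ℝ η x (EuclideanSpace.single i 1) : ℂ) * u x) := by
  have hη' : ContDiff ℝ ∞ (fun x => fderiv ℝ η x (EuclideanSpace.single i 1)) :=
    (hη.fderiv_right (by simp)).clm_apply contDiff_const
  have hL : ∀ {ρ : E d → ℝ} {w : E d → ℂ}, Continuous ρ → LocallyIntegrableOn w U →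
      LocallyIntegrableOn (fun x => (ρ x : ℂ) * w x) U := fun hρ hw =>
    hw.continuousOn_mul (Complex.continuous_ofReal.comp hρ).continuousOn hU.isLocallyClosed
  refine ⟨hL hη.continuous h.1, (hL hη.continuous h.2.1).add (hL hη'.continuous h.1), fun φ hφ => ?_⟩
  have e := h.2.2 _ (hφ.ofReal_mul hη)
  have hp : ∀ x, LocalFEM.partialDeriv i (fun x => (η x : ℂ) * φ x) x =
      (η x : ℂ) * LocalFEM.partialDeriv i φ x
        + (fderiv ℝ η x (EuclideanSpace.single i 1) : ℂ) * φ x := by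
    intro x
    have h1 : HasFDerivAt (fun x => (η x : ℂ)) (Complex.ofRealCLM.comp (fderiv ℝ η x)) x :=
      Complex.ofRealCLM.hasFDerivAt.comp x (hη.differentiable (by simp) x).hasFDerivAt
    have h2 := h1.mul (hφ.1.differentiable (by simp) x).hasFDerivAt
    have h3 : fderiv ℝ (fun x => (η x : ℂ) * φ x) x = _ := h2.fderiv
    simp only [LocalFEM.partialDeriv]
    rw [h3]
    simp [mul_comm]
  have hi := hφ.ofReal_mul hη'
  have ht := (hφ.partialDeriv i).ofReal_mul hη
  simp only [hp, mul_add] at e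
  rw [integral_add (integrableOn_mul_testFun h.1 ht) (integrableOn_mul_testFun h.1 hi)] at e
  have e1 : ∫ x in U, ((η x : ℂ) * g x + (fderiv ℝ η x (EuclideanSpace.single i 1) : ℂ) * u x) * φ x
      = (∫ x in U, g x * ((η x : ℂ) * φ x)) +
        ∫ x in U, u x * ((fderiv ℝ η x (EuclideanSpace.single i 1) : ℂ) * φ x) := by
    rw [← integral_add (integrableOn_mul_testFun h.2.1 (hφ.ofReal_mul hη))
      (integrableOn_mul_testFun h.1 hi)]
    exact integral_congr_ae (Filter.Eventually.of_forall fun x => by ring)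
  have e2 : ∫ x in U, (η x : ℂ) * u x * LocalFEM.partialDeriv i φ x
      = ∫ x in U, u x * ((η x : ℂ) * LocalFEM.partialDeriv i φ x) :=
    integral_congr_ae (Filter.Eventually.of_forall fun x => by ring)
  rw [e1, e2, neg_add, ← e]
  ring

end HasWeakDeriv

end WeakDerivatives

/-! ### Continuous piecewise polynomials are weakly differentiable. -/

section PiecewisePolynomials

open Filter Topology Set

variable {d : ℕ} {U Ω : Set (E d)}

/-- A continuous function on `[0, 1]` that is `L`-Lipschitz on each of finitely many closed sets
covering `[0, 1]` satisfies the Lipschitz estimate between the end points. -/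
lemma norm_sub_le_of_finite_closed_cover {κ : Type*} {f : ℝ → ℂ} {L : ℝ} (s : Finset κ)
    (F : κ → Set ℝ) (hF : ∀ k ∈ s, IsClosed (F k)) (hf : ContinuousOn f (Icc 0 1))
    (hcov : ∀ t ∈ Icc (0 : ℝ) 1, ∃ k ∈ s, t ∈ F k)
    (hL : ∀ k ∈ s, ∀ a ∈ F k ∩ Icc 0 1, ∀ b ∈ F k ∩ Icc 0 1, ‖f a - f b‖ ≤ L * |a - b|) :
    ‖f 1 - f 0‖ ≤ L := by
  -- Continuous induction along `[0, 1]`: `S` is closed there, and it remains to move to the right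
  -- from each of its points.
  set S : Set ℝ := {t | ‖f t - f 0‖ ≤ L * t} with hS
  have hcl : IsClosed (S ∩ Icc 0 1) := by
    have h1 : ContinuousOn (fun t => ‖f t - f 0‖) (Icc (0 : ℝ) 1) := by fun_prop
    have h2 : ContinuousOn (fun t => L * t) (Icc (0 : ℝ) 1) := by fun_prop
    convert isClosed_Icc.isClosed_le h1 h2 using 1
    ext t
    simp [hS, and_comm]
  have key : Icc (0 : ℝ) 1 ⊆ S := by
    refine hcl.Icc_subset_of_forall_exists_gt (by simp [hS]) ?_
    rintro x ⟨hxS, hx0, hx1⟩ y hy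
    have hmem : Ioc x (min y 1) ∈ 𝓝[>] x := Ioc_mem_nhdsGT (lt_min hy hx1)
    -- By finiteness one `F k` contains points arbitrarily close to `x` on the right. Closedness
    -- puts `x` itself in `F k`, so the Lipschitz bound on `F k` applies from `x`. The sets need not
    -- be intervals.
    obtain ⟨k, hk, hfreq⟩ : ∃ k ∈ s, ∃ᶠ t in 𝓝[>] x, t ∈ F k := by
      by_contra hcon
      push Not at hcon
      have h1 : ∀ᶠ t in 𝓝[>] x, ∀ k ∈ s, t ∉ F k := (Finset.eventually_all s).2 hcon
      obtain ⟨t, ht1, ht2⟩ := (h1.and hmem).exists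
      obtain ⟨k, hk, htk⟩ := hcov t ⟨hx0.trans ht2.1.le, ht2.2.trans (min_le_right _ _)⟩
      exact ht1 k hk htk
    have hxk : x ∈ F k := (hF k hk).mem_of_frequently_of_tendsto hfreq
      (tendsto_id.mono_left nhdsWithin_le_nhds)
    obtain ⟨t, htk, ht⟩ := (hfreq.and_eventually hmem).exists
    refine ⟨t, ?_, ht.1, ht.2.trans (min_le_left _ _)⟩
    have h2 := hL k hk t ⟨htk, hx0.trans ht.1.le, ht.2.trans (min_le_right _ _)⟩ x
      ⟨hxk, hx0, hx1.le⟩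
    rw [abs_of_pos (sub_pos.2 ht.1)] at h2
    have h3 := norm_sub_le_norm_sub_add_norm_sub (f t) (f x) (f 0)
    have h4 : ‖f x - f 0‖ ≤ L * x := hxS
    show ‖f t - f 0‖ ≤ L * t
    linarith
  simpa [hS] using key (right_mem_Icc.2 zero_le_one)

lemma contDiff_eval_mvPolynomial (p : MvPolynomial (Fin d) ℂ) :
    ContDiff ℝ ∞ fun x : E d => MvPolynomial.eval (fun i => ((x i : ℝ) : ℂ)) p := by
  induction p using MvPolynomial.induction_on with
  | C a => simpa using contDiff_const
  | add p q hp hq => simpa using hp.add hq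
  | mul_X p i hp =>
    simp only [map_mul, MvPolynomial.eval_X]
    refine hp.mul (Complex.ofRealCLM.contDiff.comp ?_)
    exact (EuclideanSpace.proj (𝕜 := ℝ) i).contDiff

/-- On an element `v` is a polynomial, hence Lipschitz there as the restriction of a smooth function
on a ball, even if the element is not convex. Along a segment the finitely many closed elements are
glued by continuity. Only segments inside the closure are allowed, as `Ω` need not be convex. -/
lemma IsFESpace.exists_lipschitz_segment (hb : Bornology.IsBounded Ω) {T : Mesh Ω}
    {V : Submodule ℂ (E d → ℂ)} (hV : IsFESpace T V) {v : E d → ℂ} (hv : v ∈ V) :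
    ∃ L : ℝ, 0 ≤ L ∧ ∀ x y, segment ℝ x y ⊆ closure Ω → ‖v x - v y‖ ≤ L * ‖x - y‖ := by
  obtain ⟨hc, hp⟩ := hV v hv
  obtain ⟨R, hR⟩ := hb.closure.subset_closedBall (0 : E d)
  have hex : ∀ τ : Set (E d), ∃ K : NNReal, τ ∈ T.elems →
      ∀ x ∈ τ, ∀ y ∈ τ, ‖v x - v y‖ ≤ K * ‖x - y‖ := by
    intro τ
    by_cases hτ : τ ∈ T.elems
    · obtain ⟨p, hp⟩ := hp τ hτ
      obtain ⟨K, hK⟩ := (contDiff_eval_mvPolynomial p).contDiffOn.exists_lipschitzOnWith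
        (by simp) (convex_closedBall (0 : E d) R) (isCompact_closedBall 0 R)
      refine ⟨K, fun _ x hx y hy => ?_⟩
      have hsub : τ ⊆ closure Ω := T.cover ▸ Set.subset_biUnion_of_mem (u := id) hτ
      have := hK.dist_le_mul x (hR (hsub hx)) y (hR (hsub hy))
      rwa [dist_eq_norm, dist_eq_norm, ← hp x hx, ← hp y hy] at this
    · exact ⟨0, fun h => absurd h hτ⟩
  choose K hK using hex
  refine ⟨∑ τ ∈ T.elems, (K τ : ℝ), Finset.sum_nonneg fun _ _ => NNReal.coe_nonneg _, ?_⟩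
  intro x y hxy
  have hline : ∀ t ∈ Icc (0 : ℝ) 1, AffineMap.lineMap y x t ∈ closure Ω := fun t ht =>
    hxy (by rw [segment_symm, segment_eq_image_lineMap]; exact ⟨t, ht, rfl⟩)
  have hlc : Continuous fun t : ℝ => (AffineMap.lineMap y x t : E d) := AffineMap.lineMap_continuous
  have := norm_sub_le_of_finite_closed_cover (f := fun t => v (AffineMap.lineMap y x t))
    (L := (∑ τ ∈ T.elems, (K τ : ℝ)) * ‖x - y‖) T.elems
    (fun τ => (fun t : ℝ => (AffineMap.lineMap y x t : E d)) ⁻¹' τ)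
    (fun τ hτ => (T.isCompact τ hτ).isClosed.preimage hlc)
    (hc.comp hlc.continuousOn hline) ?_ ?_
  · simpa using this
  · intro t ht
    have := hline t ht
    rw [← T.cover] at this
    simpa using this
  · rintro τ hτ a ⟨ha, -⟩ b ⟨hb, -⟩
    refine (hK τ hτ _ ha _ hb).trans ?_
    have h1 : ‖(AffineMap.lineMap y x a : E d) - AffineMap.lineMap y x b‖ = |a - b| * ‖x - y‖ := by
      rw [← dist_eq_norm, dist_lineMap_lineMap, dist_eq_norm, dist_eq_norm, norm_sub_rev y x,
        Real.norm_eq_abs]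
    rw [h1]
    have h2 : (K τ : ℝ) ≤ ∑ τ ∈ T.elems, (K τ : ℝ) :=
      Finset.single_le_sum (f := fun τ => (K τ : ℝ)) (fun _ _ => NNReal.coe_nonneg _) hτ
    have := mul_le_mul_of_nonneg_right h2 (mul_nonneg (abs_nonneg (a - b)) (norm_nonneg (x - y)))
    linarith

lemma Mesh.ae_mem_interior (T : Mesh Ω) :
    ∀ᵐ x ∂volume.restrict Ω, ∃ τ ∈ T.elems, x ∈ interior τ := by
  have hn : volume (⋃ τ ∈ T.elems, frontier τ) = 0 :=
    (measure_biUnion_null_iff T.elems.countable_toSet).2 T.frontier_null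
  have h1 : ∀ᵐ x ∂volume.restrict Ω, x ∉ ⋃ τ ∈ T.elems, frontier τ :=
    ae_restrict_of_ae (measure_eq_zero_iff_ae_notMem.1 hn)
  have h2 : ∀ᵐ x ∂volume.restrict Ω, x ∈ closure Ω :=
    ae_mono (Measure.restrict_mono subset_closure le_rfl)
      (ae_restrict_mem isClosed_closure.measurableSet)
  filter_upwards [h1, h2] with x hx hxc
  rw [← T.cover] at hxc
  simp only [mem_iUnion, exists_prop, not_exists, not_and] at hx hxc
  obtain ⟨τ, hτ, hxτ⟩ := hxc
  refine ⟨τ, hτ, ?_⟩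
  by_contra hni
  exact hx τ hτ ⟨subset_closure hxτ, hni⟩

lemma IsFESpace.ae_differentiableAt {T : Mesh Ω}
    {V : Submodule ℂ (E d → ℂ)} (hV : IsFESpace T V) {v : E d → ℂ} (hv : v ∈ V) :
    ∀ᵐ x ∂volume.restrict Ω, DifferentiableAt ℝ v x := by
  filter_upwards [T.ae_mem_interior] with x ⟨τ, hτ, hx⟩
  obtain ⟨p, hp⟩ := (hV v hv).2 τ hτ
  refine ((contDiff_eval_mvPolynomial p).differentiable (by simp) x).congr_of_eventuallyEq ?_
  filter_upwards [isOpen_interior.mem_nhds hx] with y hy using hp y (interior_subset hy)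

/-- Valid at every point of `U`: where `u` is not differentiable, `fderiv` is `0`. -/
lemma norm_partialDeriv_le_of_lipschitz_segment (hU : IsOpen U) {u : E d → ℂ} {L : ℝ} (hL0 : 0 ≤ L)
    (hL : ∀ x y, segment ℝ x y ⊆ U → ‖u x - u y‖ ≤ L * ‖x - y‖) {x : E d} (hx : x ∈ U) (i : Fin d) :
    ‖partialDeriv i u x‖ ≤ L := by
  obtain ⟨δ, hδ, hball⟩ := Metric.isOpen_iff.1 hU x hx
  have h1 : ‖fderiv ℝ u x‖ ≤ L := by
    refine norm_fderiv_le_of_lip' ℝ hL0 ?_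
    filter_upwards [Metric.ball_mem_nhds x hδ] with y hy
    exact hL y x (((convex_ball x δ).segment_subset hy (Metric.mem_ball_self hδ)).trans hball)
  calc ‖partialDeriv i u x‖ ≤ ‖fderiv ℝ u x‖ * ‖(EuclideanSpace.single i (1 : ℝ) : E d)‖ :=
        ContinuousLinearMap.le_opNorm _ _
    _ ≤ L := by simpa using h1

/-- A function that is Lipschitz on segments and almost everywhere differentiable has its classical
partial derivatives as weak derivatives. -/
lemma hasWeakDeriv_of_lipschitz_segment (hU : IsOpen U) {u : E d → ℂ} {L : ℝ} (hL0 : 0 ≤ L)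
    (hc : ContinuousOn u U)
    (hL : ∀ x y, segment ℝ x y ⊆ U → ‖u x - u y‖ ≤ L * ‖x - y‖)
    (hd : ∀ᵐ x ∂volume.restrict U, DifferentiableAt ℝ u x) (i : Fin d) :
    HasWeakDeriv U i u (partialDeriv i u) := by
  have hm : Measurable (partialDeriv i u) := measurable_fderiv_apply_const ℝ u _
  have hloc : LocallyIntegrableOn u U := hc.locallyIntegrableOn hU.measurableSet
  refine ⟨hloc, ?_, fun φ hφ => ?_⟩
  · refine LocallyIntegrableOn.congr (indicator_ae_eq_restrict hU.measurableSet)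
      ((locallyIntegrableOn_const L).mono
        (hm.indicator hU.measurableSet).aestronglyMeasurable (Eventually.of_forall fun x => ?_))
    by_cases hx : x ∈ U
    · rw [indicator_of_mem hx, Real.norm_of_nonneg hL0]
      exact norm_partialDeriv_le_of_lipschitz_segment hU hL0 hL hx i
    · simp [hx]
  -- Summation by parts for difference quotients: translation invariance moves the shift from the
  -- zero extension `w` of `u` to `φ`, and dominated convergence is used on both sides as the step
  -- `t` decreases to `0`. For `t ≤ δ` the shifted support of `φ` stays in `U`.
  set e : E d := EuclideanSpace.single i 1 with he
  have hen : ‖e‖ = 1 := by simp [he]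
  set w : E d → ℂ := U.indicator u with hw
  obtain ⟨δ, hδ, hδU⟩ := hφ.2.1.exists_cthickening_subset_open hU hφ.2.2
  have hmem : Ioc 0 δ ∈ 𝓝[>] (0 : ℝ) := Ioc_mem_nhdsGT hδ
  have hnear : ∀ x ∈ tsupport φ, ∀ y, dist y x ≤ δ → y ∈ Metric.cthickening δ (tsupport φ) :=
    fun x hx y hy => Metric.mem_cthickening_of_dist_le y x δ _ hx hy
  have hshift : ∀ t ∈ Ioc 0 δ, IsTestFun U fun x => φ (x + t • (-e)) := by
    intro t ht
    refine ⟨hφ.1.comp (contDiff_id.add contDiff_const), ?_, ?_⟩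
    · exact hφ.2.1.comp_homeomorph (Homeomorph.addRight (t • (-e)))
    · have : tsupport (fun x => φ (x + t • (-e))) ⊆ Metric.cthickening δ (tsupport φ) := by
        refine closure_minimal (fun x hx => ?_) Metric.isClosed_cthickening
        refine hnear (x + t • (-e)) (subset_tsupport _ hx) x ?_
        simp [dist_eq_norm, norm_smul, hen, abs_of_pos ht.1, ht.2]
      exact this.trans hδU
  have hint : ∀ {ψ : E d → ℂ}, IsTestFun U ψ → Integrable fun x => w x * ψ x := by
    intro ψ hψ
    have h1 := (integrableOn_mul_testFun hloc hψ).integrable_indicator hU.measurableSet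
    refine h1.congr (Eventually.of_forall fun x => ?_)
    by_cases hx : x ∈ U <;> simp [hw, hx]
  have hwm : AEStronglyMeasurable w := 
    (aestronglyMeasurable_indicator_iff hU.measurableSet).2 (hc.aestronglyMeasurable hU.measurableSet)
  obtain ⟨K, hK⟩ := hφ.1.lipschitzWith_of_hasCompactSupport hφ.2.1 (by simp)
  have lim1 : Tendsto (fun t : ℝ => ∫ x, w x * (t⁻¹ • (φ (x + t • (-e)) - φ x))) (𝓝[>] 0)
      (𝓝 (∫ x, w x * (-partialDeriv i φ x))) := by
    refine tendsto_integral_filter_of_dominated_convergence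
      ((Metric.cthickening δ (tsupport φ)).indicator fun x => ‖u x‖ * K) ?_ ?_ ?_ ?_
    · filter_upwards with t
      refine hwm.mul (Continuous.aestronglyMeasurable ?_)
      have := hφ.continuous
      fun_prop
    · filter_upwards [hmem] with t ht
      filter_upwards with x
      by_cases hx : x ∈ Metric.cthickening δ (tsupport φ)
      · rw [indicator_of_mem hx, hw, indicator_of_mem (hδU hx), norm_mul]
        gcongr
        rw [norm_smul, norm_inv, Real.norm_of_nonneg ht.1.le, inv_mul_le_iff₀ ht.1]
        have := hK.dist_le_mul (x + t • (-e)) x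
        simpa [dist_eq_norm, norm_smul, hen, abs_of_pos ht.1, mul_comm] using this
      · have h1 : φ x = 0 := image_eq_zero_of_notMem_tsupport fun h =>
          hx (Metric.self_subset_cthickening _ h)
        have h2 : φ (x + t • (-e)) = 0 := image_eq_zero_of_notMem_tsupport fun h =>
          hx (hnear _ h x (by simp [dist_eq_norm, norm_smul, hen, abs_of_pos ht.1, ht.2]))
        rw [h1, h2, indicator_of_notMem hx]
        simp
    · have hKc : IsCompact (Metric.cthickening δ (tsupport φ)) := hφ.2.1.cthickening
      exact (((hc.mono hδU).norm.mul continuousOn_const).integrableOn_compact hKc).integrable_indicator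
        hKc.measurableSet
    · filter_upwards with x
      have h1 := ((hφ.1.differentiable (by simp) x).hasFDerivAt.hasLineDerivAt (-e)).tendsto_slope_zero_right
      have h2 : fderiv ℝ φ x (-e) = -partialDeriv i φ x := by rw [map_neg]; rfl
      rw [h2] at h1
      exact h1.const_mul _
  have lim2 : Tendsto (fun t : ℝ => ∫ x, (t⁻¹ • (w (x + t • e) - w x)) * φ x) (𝓝[>] 0)
      (𝓝 (∫ x, U.indicator (partialDeriv i u) x * φ x)) := by
    refine tendsto_integral_filter_of_dominated_convergence (fun x => L * ‖φ x‖) ?_ ?_ ?_ ?_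
    · filter_upwards with t
      have h1 : AEStronglyMeasurable fun x => w (x + t • e) := hwm.comp_quasiMeasurePreserving
        (measurePreserving_add_right volume (t • e)).quasiMeasurePreserving
      exact ((h1.sub hwm).const_smul t⁻¹).mul hφ.continuous.aestronglyMeasurable
    · filter_upwards [hmem] with t ht
      filter_upwards with x
      rw [norm_mul]
      by_cases hx : x ∈ tsupport φ
      · gcongr
        have hball : Metric.closedBall x δ ⊆ U := fun y hy => hδU (hnear x hx y hy)
        have hmx : x ∈ Metric.closedBall x δ := Metric.mem_closedBall_self hδ.le
        have hmt : x + t • e ∈ Metric.closedBall x δ := by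
          simp [norm_smul, hen, abs_of_pos ht.1, ht.2]
        rw [hw, indicator_of_mem (hball hmx), indicator_of_mem (hball hmt), norm_smul, norm_inv,
          Real.norm_of_nonneg ht.1.le, inv_mul_le_iff₀ ht.1]
        have := hL (x + t • e) x (((convex_closedBall x δ).segment_subset hmt hmx).trans hball)
        simpa [norm_smul, hen, abs_of_pos ht.1, mul_comm] using this
      · simp [image_eq_zero_of_notMem_tsupport hx]
    · exact ((hφ.continuous.norm.integrable_of_hasCompactSupport hφ.2.1.norm)).const_mul L
    · have hd' := (ae_restrict_iff' hU.measurableSet).1 hd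
      filter_upwards [hd'] with x hdx
      by_cases hx : x ∈ U
      · have h1 := ((hdx hx).hasFDerivAt.hasLineDerivAt e).tendsto_slope_zero_right
        rw [indicator_of_mem hx]
        refine Tendsto.mul_const _ (h1.congr' ?_)
        have hcont : Tendsto (fun t : ℝ => x + t • e) (𝓝[>] 0) (𝓝 x) := by
          have : Continuous fun t : ℝ => x + t • e := by fun_prop
          simpa using (this.tendsto 0).mono_left nhdsWithin_le_nhds
        filter_upwards [hcont (hU.mem_nhds hx)] with t ht
        rw [hw, indicator_of_mem hx, indicator_of_mem (show x + t • e ∈ U from ht)]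
      · simp [hφ.zero_of_notMem hx]
  have heq : (fun t : ℝ => ∫ x, (t⁻¹ • (w (x + t • e) - w x)) * φ x) =ᶠ[𝓝[>] 0]
      fun t : ℝ => ∫ x, w x * (t⁻¹ • (φ (x + t • (-e)) - φ x)) := by
    filter_upwards [hmem] with t ht
    have hs := hint (hshift t ht)
    have hs' : Integrable fun x => w (x + t • e) * φ x := by
      have := hs.comp_add_right (t • e)
      simpa using this
    have htr : ∫ x, w (x + t • e) * φ x = ∫ x, w x * φ (x + t • (-e)) := by
      rw [← integral_add_right_eq_self (fun x => w x * φ (x + t • (-e))) (t • e)]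
      simp
    calc ∫ x, (t⁻¹ • (w (x + t • e) - w x)) * φ x
        = ∫ x, (t⁻¹ : ℝ) • (w (x + t • e) * φ x - w x * φ x) := by
          congr 1; ext x; simp only [Complex.real_smul]; ring
      _ = (t⁻¹ : ℝ) • ((∫ x, w x * φ (x + t • (-e))) - ∫ x, w x * φ x) := by
          rw [integral_smul, integral_sub hs' (hint hφ), htr]
      _ = ∫ x, w x * (t⁻¹ • (φ (x + t • (-e)) - φ x)) := by
          rw [← integral_sub hs (hint hφ), ← integral_smul]
          congr 1; ext x; simp only [Complex.real_smul]; ring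
  have hfin := tendsto_nhds_unique (lim2.congr' heq) lim1
  have e1 : ∫ x in U, u x * partialDeriv i φ x = ∫ x, w x * partialDeriv i φ x := by
    rw [← integral_indicator hU.measurableSet]
    congr 1; ext x
    by_cases hx : x ∈ U <;> simp [hw, hx]
  have e2 : ∫ x in U, partialDeriv i u x * φ x = ∫ x, U.indicator (partialDeriv i u) x * φ x := by
    rw [← integral_indicator hU.measurableSet]
    congr 1; ext x
    by_cases hx : x ∈ U <;> simp [hx]
  rw [e1, e2, hfin, ← integral_neg]
  simp

end PiecewisePolynomials

/-! ### Neighbourhoods of `G` in `Ω`, and cut-off functions. -/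

section Geometry

open Filter Topology Set

variable {d : ℕ} {U Ω Ω₀ G : Set (E d)}

lemma inter_frontier_nonempty_of_isPreconnected {X : Type*} [TopologicalSpace X] {S A : Set X}
    (hS : IsPreconnected S) {x y : X} (hx : x ∈ S) (hxA : x ∈ A) (hy : y ∈ S) (hyA : y ∉ A) :
    (S ∩ frontier A).Nonempty := by
  by_contra hcon
  have hnf : ∀ z ∈ S, z ∉ frontier A := fun z hz hzA => hcon ⟨z, hz, hzA⟩
  have hcov : S ⊆ interior A ∪ (closure A)ᶜ := fun z hz => by
    by_cases hzA : z ∈ closure A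
    · left
      by_contra hzi
      exact hnf z hz ⟨hzA, hzi⟩
    · exact Or.inr hzA
  have hxi : x ∈ interior A := by
    by_contra h
    exact hnf x hx ⟨subset_closure hxA, h⟩
  have hyc : y ∈ (closure A)ᶜ := fun h => hnf y hy ⟨h, fun hi => hyA (interior_subset hi)⟩
  obtain ⟨z, -, hz1, hz2⟩ := hS _ _ isOpen_interior isClosed_closure.isOpen_compl hcov
    ⟨x, hx, hxi⟩ ⟨y, hy, hyc⟩
  exact hz2 (subset_closure (interior_subset hz1))

lemma IsPolyhedralDomain.isOpen (h : IsPolyhedralDomain Ω) : IsOpen Ω := by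
  obtain ⟨-, ⟨K, hK⟩, -⟩ := h
  rw [hK]
  exact isOpen_interior

lemma IsPolyhedralDomain.isBounded (h : IsPolyhedralDomain Ω) : Bornology.IsBounded Ω := by
  obtain ⟨-, ⟨K, hK⟩, -⟩ := h
  rw [hK]
  refine Bornology.IsBounded.subset ?_ interior_subset
  refine (Bornology.isBounded_biUnion_finset K).2 fun s _ => ?_
  exact isBounded_convexHull.2 s.finite_toSet.isBounded

lemma mem_of_mem_closure_of_notMem_frontier (hΩ : IsOpen Ω) {x : E d} (hx : x ∈ closure Ω)
    (hx' : x ∉ frontier Ω) : x ∈ Ω := by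
  by_contra h
  exact hx' (hΩ.frontier_eq ▸ ⟨hx, h⟩)

/-- Relative separation `G ⊂⊂ Ω₀` implies metric separation of `G` from `Ω \ Ω₀`, because `Ω` does
not touch itself along its boundary. -/
lemma WellInside.exists_thickening_subset (hΩ : IsPolyhedralDomain Ω)
    (h : WellInside Ω G Ω₀) : ∃ ε > 0, Ω ∩ Metric.thickening ε G ⊆ Ω₀ := by
  obtain ⟨hGΩ₀, hΩ₀Ω, δ, hδ, hsep⟩ := h
  -- Each point of the closure has a neighbourhood `W` of radius below `δ / 2` with connected trace
  -- on `Ω`; a Lebesgue number of this cover is the `ε` sought. The empty set serves only to make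
  -- the choice total.
  have hex : ∀ z : E d, ∃ W : Set (E d), IsOpen W ∧ (z ∈ closure Ω → z ∈ W) ∧
      W ⊆ Metric.ball z (δ / 2) ∧ IsPreconnected (W ∩ Ω) := by
    intro z
    by_cases hz : z ∈ frontier Ω
    · obtain ⟨W, h1, h2, h3, h4⟩ := hΩ.2.2 z hz (δ / 2) (half_pos hδ)
      exact ⟨W, h1, fun _ => h2, h3, h4.isPreconnected⟩
    · by_cases hzΩ : z ∈ Ω
      · obtain ⟨r, hr, hball⟩ := Metric.isOpen_iff.1 hΩ.isOpen z hzΩ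
        refine ⟨Metric.ball z (min r (δ / 2)), Metric.isOpen_ball,
          fun _ => Metric.mem_ball_self (lt_min hr (half_pos hδ)),
          Metric.ball_subset_ball (min_le_right _ _), ?_⟩
        rw [inter_eq_self_of_subset_left ((Metric.ball_subset_ball (min_le_left _ _)).trans hball)]
        exact (convex_ball _ _).isPreconnected
      · exact ⟨∅, isOpen_empty,
          fun hc => absurd (mem_of_mem_closure_of_notMem_frontier hΩ.isOpen hc hz) hzΩ,
          empty_subset _, by simpa using isPreconnected_empty⟩
  choose W hWo hWm hWb hWc using hex
  obtain ⟨ε, hε, hleb⟩ := lebesgue_number_lemma_of_metric hΩ.isBounded.isCompact_closure hWo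
    (fun z hz => mem_iUnion.2 ⟨z, hWm z hz⟩)
  refine ⟨ε, hε, fun y hy => ?_⟩
  by_contra hyΩ₀
  obtain ⟨x, hxG, hxy⟩ := Metric.mem_thickening_iff.1 hy.2
  have hxΩ : x ∈ Ω := hΩ₀Ω (hGΩ₀ hxG)
  obtain ⟨z, hz⟩ := hleb x (subset_closure hxΩ)
  have hxW : x ∈ W z ∩ Ω := ⟨hz (Metric.mem_ball_self hε), hxΩ⟩
  have hyW : y ∈ W z ∩ Ω := ⟨hz hxy, hy.1⟩
  -- `W z ∩ Ω` is connected and contains `x ∈ G` and `y ∉ Ω₀`, so it meets both `∂G` and `∂Ω₀`, at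
  -- points of `Ω` less than `δ` apart. This contradicts the separation.
  obtain ⟨p, hp, hpG⟩ := inter_frontier_nonempty_of_isPreconnected (hWc z) hxW hxG hyW
    fun h => hyΩ₀ (hGΩ₀ h)
  obtain ⟨q, hq, hqΩ₀⟩ := inter_frontier_nonempty_of_isPreconnected (hWc z) hxW (hGΩ₀ hxG) hyW hyΩ₀
  have hnf : ∀ p ∈ Ω, p ∉ frontier Ω := fun p hp hpf =>
    (hΩ.isOpen.frontier_eq ▸ hpf : p ∈ closure Ω \ Ω).2 hp
  have h1 := hsep p ⟨hpG, hnf p hp.2⟩ q ⟨hqΩ₀, hnf q hq.2⟩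
  have h2 : dist p z < δ / 2 := hWb z hp.1
  have h3 : dist q z < δ / 2 := hWb z hq.1
  have h4 := dist_triangle_right p q z
  linarith

/-- A boundary point of `U` off `∂Ω` lies in `Ω \ U`, so its distance to `G` is at least `c`, while
`∂S` is within `b` of `G`; the gap is `c - b`. This serves for the support of `η²` in a
neighbourhood and for that of `v` in `Ω₀`. -/
lemma wellInside_of_subset_cthickening (hΩ : IsOpen Ω) (hU : IsOpen U) {S : Set (E d)} {b c : ℝ}
    (hb : 0 ≤ b) (hbc : b < c) (hS : S ⊆ Metric.cthickening b G) (hSU : S ⊆ U) (hUΩ : U ⊆ Ω)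
    (hsub : Ω ∩ Metric.thickening c G ⊆ U) : WellInside Ω S U := by
  refine ⟨hSU, hUΩ, c - b, sub_pos.2 hbc, fun x hx y hy => ?_⟩
  have hxb : x ∈ Metric.cthickening b G :=
    closure_minimal hS Metric.isClosed_cthickening hx.1.1
  have hyΩ : y ∈ Ω := mem_of_mem_closure_of_notMem_frontier hΩ (closure_mono hUΩ hy.1.1) hy.2
  have hyU : y ∉ U := (hU.frontier_eq ▸ hy.1 : y ∈ closure U \ U).2
  have hyc : y ∉ Metric.thickening c G := fun h => hyU (hsub ⟨hyΩ, h⟩)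
  rw [Metric.mem_thickening_iff_infEDist_lt, not_lt] at hyc
  rw [Metric.mem_cthickening_iff] at hxb
  have h1 : ENNReal.ofReal c ≤ ENNReal.ofReal (b + dist y x) := by
    rw [ENNReal.ofReal_add hb dist_nonneg, ← edist_dist]
    exact hyc.trans (Metric.infEDist_le_infEDist_add_edist.trans (by gcongr))
  have h2 := (ENNReal.ofReal_le_ofReal_iff (add_nonneg hb dist_nonneg)).1 h1
  rw [dist_comm] at h2
  linarith

/-- A smooth function with values in `[0, 1]` and bounded first derivatives on `Ω`. -/
structure IsCutoff (Ω : Set (E d)) (η : E d → ℝ) (K : ℝ) : Prop where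
  contDiff : ContDiff ℝ ∞ η
  abs_le_one : ∀ x, |η x| ≤ 1
  nonneg : 0 ≤ K
  deriv_le : ∀ x ∈ Ω, ∀ i, |fderiv ℝ η x (EuclideanSpace.single i 1)| ≤ K

lemma exists_isCutoff (hb : Bornology.IsBounded Ω) (G : Set (E d)) {a b : ℝ} (hb0 : 0 < b)
    (hab : a < b) :
    ∃ (η : E d → ℝ) (K : ℝ), IsCutoff Ω η K ∧ (∀ x ∈ Metric.cthickening a G, η x = 1) ∧
      ∀ x ∉ Metric.thickening b G, η x = 0 := by
  obtain ⟨f, hf0, hf1, hf⟩ := exists_contMDiffMap_zero_one_of_isClosed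
    (modelWithCornersSelf ℝ (E d)) (n := (⊤ : ℕ∞))
    (s := (Metric.thickening b G)ᶜ) (t := Metric.cthickening a G)
    Metric.isOpen_thickening.isClosed_compl Metric.isClosed_cthickening
    (disjoint_left.2 fun x hx hx' => hx (Metric.cthickening_subset_thickening' hb0 hab G hx'))
  have hc : ContDiff ℝ ∞ f := f.contMDiff.contDiff
  have hcont : Continuous fun x => ‖fderiv ℝ f x‖ := (hc.continuous_fderiv (by simp)).norm
  obtain ⟨K, hK⟩ := hb.isCompact_closure.exists_bound_of_continuousOn hcont.continuousOn
  refine ⟨f, max K 0, ⟨hc, fun x => ?_, le_max_right _ _, fun x hx i => ?_⟩, hf1, hf0⟩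
  · rw [abs_of_nonneg (hf x).1]
    exact (hf x).2
  · calc |fderiv ℝ f x (EuclideanSpace.single i 1)|
        ≤ ‖fderiv ℝ f x‖ * ‖(EuclideanSpace.single i (1 : ℝ) : E d)‖ := by
          rw [← Real.norm_eq_abs]
          exact ContinuousLinearMap.le_opNorm _ _
      _ ≤ max K 0 := by
          have := hK x (subset_closure hx)
          rw [norm_norm] at this
          simpa using Or.inl this

lemma isOpen_inter_thickening (hΩ : IsOpen Ω) (s : ℝ) : IsOpen (Ω ∩ Metric.thickening s G) :=
  hΩ.inter Metric.isOpen_thickening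

end Geometry

/-! ### Norms in terms of weak gradients, `H¹₀`, and the dual norm. -/

section SobolevNorms

open Filter Topology Set

variable {d : ℕ} {U U' Ω Ω₀ G : Set (E d)} {u v φ : E d → ℂ} {p q : Fin d → E d → ℂ} {K : ℝ}

/-- `|u|² + ∑ᵢ |pᵢ|²` at a point; `p` stands for the gradient of `u`. -/
def gradSq (u : E d → ℂ) (p : Fin d → E d → ℂ) (x : E d) : ℝ :=
  ‖u x‖ ^ 2 + ∑ i, ‖p i x‖ ^ 2

lemma gradSq_nonneg (u : E d → ℂ) (p : Fin d → E d → ℂ) (x : E d) : 0 ≤ gradSq u p x := by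
  unfold gradSq; positivity

lemma sq_norm_le_gradSq (u : E d → ℂ) (p : Fin d → E d → ℂ) (x : E d) :
    ‖u x‖ ^ 2 ≤ gradSq u p x :=
  le_add_of_nonneg_right (by positivity)

lemma sq_norm_grad_le_gradSq (u : E d → ℂ) (p : Fin d → E d → ℂ) (i : Fin d) (x : E d) :
    ‖p i x‖ ^ 2 ≤ gradSq u p x := by
  have := Finset.single_le_sum (f := fun i => ‖p i x‖ ^ 2) (fun _ _ => by positivity)
    (Finset.mem_univ i)
  unfold gradSq
  have h2 : 0 ≤ ‖u x‖ ^ 2 := by positivity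
  linarith

lemma norm_le_sqrt_gradSq (u : E d → ℂ) (p : Fin d → E d → ℂ) (x : E d) :
    ‖u x‖ ≤ √(gradSq u p x) := Real.le_sqrt_of_sq_le (sq_norm_le_gradSq u p x)

lemma norm_grad_le_sqrt_gradSq (u : E d → ℂ) (p : Fin d → E d → ℂ) (i : Fin d) (x : E d) :
    ‖p i x‖ ≤ √(gradSq u p x) := Real.le_sqrt_of_sq_le (sq_norm_grad_le_gradSq u p i x)

lemma sq_norm_sub_le (a b : ℂ) : ‖a - b‖ ^ 2 ≤ 2 * ‖a‖ ^ 2 + 2 * ‖b‖ ^ 2 := by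
  have h := norm_sub_le a b
  have := pow_le_pow_left₀ (norm_nonneg _) h 2
  nlinarith [sq_nonneg (‖a‖ - ‖b‖)]

lemma gradSq_sub_le (u v : E d → ℂ) (p q : Fin d → E d → ℂ) (x : E d) :
    gradSq (u - v) (p - q) x ≤ 2 * gradSq u p x + 2 * gradSq v q x := by
  unfold gradSq
  have h1 : ∑ i, ‖(p - q) i x‖ ^ 2 ≤ ∑ i, (2 * ‖p i x‖ ^ 2 + 2 * ‖q i x‖ ^ 2) :=
    Finset.sum_le_sum fun i _ => sq_norm_sub_le _ _
  rw [Finset.sum_add_distrib, ← Finset.mul_sum, ← Finset.mul_sum] at h1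
  have h2 : ‖(u - v) x‖ ^ 2 ≤ 2 * ‖u x‖ ^ 2 + 2 * ‖v x‖ ^ 2 := sq_norm_sub_le _ _
  linarith

/-- The gradient of `η u`, where `p` is the gradient of `u`. -/
def mulGrad (η : E d → ℝ) (u : E d → ℂ) (p : Fin d → E d → ℂ) (i : Fin d) (x : E d) : ℂ :=
  (η x : ℂ) * p i x + (fderiv ℝ η x (EuclideanSpace.single i 1) : ℂ) * u x

lemma IsCutoff.gradSq_mul_le {η : E d → ℝ} (h : IsCutoff Ω η K) (u : E d → ℂ)
    (p : Fin d → E d → ℂ) {x : E d} (hx : x ∈ Ω) :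
    gradSq (fun x => (η x : ℂ) * u x) (mulGrad η u p) x
      ≤ (1 + d * (1 + K) ^ 2) * gradSq u p x := by
  have hK := h.nonneg
  have h1 : ‖(η x : ℂ) * u x‖ ^ 2 ≤ gradSq u p x := by
    refine le_trans ?_ (sq_norm_le_gradSq u p x)
    gcongr
    rw [norm_mul, Complex.norm_real, Real.norm_eq_abs]
    exact mul_le_of_le_one_left (norm_nonneg _) (h.abs_le_one x)
  have h2 : ∀ i, ‖mulGrad η u p i x‖ ^ 2 ≤ (1 + K) ^ 2 * gradSq u p x := by
    intro i
    have h3 : ‖mulGrad η u p i x‖ ≤ (1 + K) * √(gradSq u p x) := by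
      refine (norm_add_le _ _).trans ?_
      rw [norm_mul, norm_mul, Complex.norm_real, Complex.norm_real, Real.norm_eq_abs,
        Real.norm_eq_abs, add_mul]
      have := h.abs_le_one x
      have := h.deriv_le x hx i
      have := norm_le_sqrt_gradSq u p x
      have := norm_grad_le_sqrt_gradSq u p i x
      gcongr
    calc ‖mulGrad η u p i x‖ ^ 2 ≤ ((1 + K) * √(gradSq u p x)) ^ 2 := by gcongr
      _ = _ := by rw [mul_pow, Real.sq_sqrt (gradSq_nonneg _ _ _)]
  calc gradSq (fun x => (η x : ℂ) * u x) (mulGrad η u p) x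
      ≤ gradSq u p x + ∑ _i : Fin d, (1 + K) ^ 2 * gradSq u p x :=
        add_le_add h1 (Finset.sum_le_sum fun i _ => h2 i)
    _ = _ := by rw [Finset.sum_const, Finset.card_univ, Fintype.card_fin, nsmul_eq_mul]; ring

lemma weakDeriv_congr (h : u =ᵐ[volume.restrict U] v) (i : Fin d) :
    weakDeriv U i u = weakDeriv U i v := by
  have : HasWeakDeriv U i u = HasWeakDeriv U i v := by
    funext g
    exact propext ⟨fun hu => hu.congr h (ae_eq_refl g), fun hv => hv.congr h.symm (ae_eq_refl g)⟩
  unfold weakDeriv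
  rw [this]

lemma wnorm0_congr (ρ : E d → ℝ) (h : u =ᵐ[volume.restrict U] v) :
    wnorm0 U ρ u = wnorm0 U ρ v := by
  unfold wnorm0
  congr 1
  exact integral_congr_ae (by filter_upwards [h] with x hx; rw [hx])

lemma norm1_congr (h : u =ᵐ[volume.restrict U] v) : norm1 U u = norm1 U v := by
  unfold norm1 wnorm1
  simp only [weakDeriv_congr h]
  congr 1
  exact integral_congr_ae (by filter_upwards [h] with x hx; rw [hx])

lemma wnorm1_nonneg (ρ : E d → ℝ) : 0 ≤ wnorm1 U ρ u := Real.sqrt_nonneg _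

lemma norm1_nonneg : 0 ≤ norm1 U u := Real.sqrt_nonneg _

lemma Coeffs.form_congr_left (L : Coeffs d) (h : u =ᵐ[volume.restrict U] v) :
    L.form U u φ = L.form U v φ := by
  unfold Coeffs.form
  simp only [weakDeriv_congr h]
  exact integral_congr_ae (by filter_upwards [h] with x hx; rw [hx])

/-- `u ∈ H¹(U)` with weak gradient `p`. -/
structure HasGrad (U : Set (E d)) (u : E d → ℂ) (p : Fin d → E d → ℂ) : Prop where
  memLp : MemLp u 2 (volume.restrict U)
  memLp_grad : ∀ i, MemLp (p i) 2 (volume.restrict U)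
  weak : ∀ i, HasWeakDeriv U i u (p i)

lemma locallyIntegrableOn_of_memLp (h : MemLp u 2 (volume.restrict U)) :
    LocallyIntegrableOn u U :=
  locallyIntegrableOn_of_locallyIntegrable_restrict (h.locallyIntegrable (by norm_num))

lemma MemH1.exists_hasGrad (h : MemH1 U u) : ∃ p, HasGrad U u p := by
  choose p hp using h.2
  exact ⟨p, h.1, fun i => (hp i).1, fun i => (hp i).2⟩

namespace HasGrad

lemma memH1 (h : HasGrad U u p) : MemH1 U u :=
  ⟨h.memLp, fun i => ⟨p i, h.memLp_grad i, h.weak i⟩⟩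

lemma mono (h : HasGrad U' u p) (hU : U ⊆ U') : HasGrad U u p :=
  ⟨h.memLp.mono_measure (Measure.restrict_mono hU le_rfl),
    fun i => (h.memLp_grad i).mono_measure (Measure.restrict_mono hU le_rfl),
    fun i => (h.weak i).mono hU⟩

lemma congr (h : HasGrad U u p) (hu : u =ᵐ[volume.restrict U] v)
    (hp : ∀ i, p i =ᵐ[volume.restrict U] q i) : HasGrad U v q :=
  ⟨h.memLp.ae_eq hu, fun i => (h.memLp_grad i).ae_eq (hp i), fun i => (h.weak i).congr hu (hp i)⟩

lemma sub (h : HasGrad U u p) (h' : HasGrad U v q) : HasGrad U (u - v) (p - q) :=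
  ⟨h.memLp.sub h'.memLp, fun i => (h.memLp_grad i).sub (h'.memLp_grad i),
    fun i => (h.weak i).sub (h'.weak i)⟩

lemma const_smul (h : HasGrad U u p) (z : ℂ) : HasGrad U (z • u) (z • p) :=
  ⟨h.memLp.const_smul z, fun i => (h.memLp_grad i).const_smul z, fun i => (h.weak i).const_smul z⟩

lemma zero : HasGrad U (0 : E d → ℂ) 0 :=
  ⟨MemLp.zero, fun _ => MemLp.zero, fun i => by
    have := (IsTestFun.zero (U := U)).hasWeakDeriv i
    have h0 : partialDeriv i (0 : E d → ℂ) = 0 := by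
      funext x
      simp [partialDeriv]
    rwa [h0] at this⟩

lemma ofReal_mul (hU : IsOpen U) (hUΩ : U ⊆ Ω) (h : HasGrad U u p) {η : E d → ℝ}
    (hη : IsCutoff Ω η K) :
    HasGrad U (fun x => (η x : ℂ) * u x) (mulGrad η u p) := by
  have hη' : ∀ i : Fin d, Continuous fun x => fderiv ℝ η x (EuclideanSpace.single i 1) := fun i =>
    (hη.contDiff.continuous_fderiv (by simp)).clm_apply continuous_const
  have key : ∀ {ρ : E d → ℝ} {C : ℝ} {w : E d → ℂ}, Continuous ρ → (∀ x ∈ U, |ρ x| ≤ C) →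
      MemLp w 2 (volume.restrict U) → MemLp (fun x => (ρ x : ℂ) * w x) 2 (volume.restrict U) := by
    intro ρ C w hρ hC hw
    refine MemLp.of_le_mul (c := C) hw
      ((Complex.continuous_ofReal.comp hρ).aestronglyMeasurable.mul hw.aestronglyMeasurable) ?_
    filter_upwards [ae_restrict_mem hU.measurableSet] with x hx
    rw [norm_mul, Complex.norm_real, Real.norm_eq_abs]
    gcongr
    exact hC x hx
  exact ⟨key hη.contDiff.continuous (fun x _ => hη.abs_le_one x) h.memLp,
    fun i => (key hη.contDiff.continuous (fun x _ => hη.abs_le_one x) (h.memLp_grad i)).add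
      (key (hη' i) (fun x hx => hη.deriv_le x (hUΩ hx) i) h.memLp),
    fun i => (h.weak i).ofReal_mul hU hη.contDiff⟩

lemma integrable_gradSq (h : HasGrad U u p) : IntegrableOn (gradSq u p) U := by
  refine Integrable.add ?_ (integrable_finsetSum _ fun i _ => ?_)
  · exact h.memLp.integrable_norm_pow (by norm_num)
  · exact (h.memLp_grad i).integrable_norm_pow (by norm_num)

lemma wnorm1_sq (hU : IsOpen U) (h : HasGrad U u p) (ρ : E d → ℝ) :
    wnorm1 U ρ u ^ 2 = ∫ x in U, ρ x ^ 2 * gradSq u p x := by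
  unfold wnorm1
  rw [Real.sq_sqrt (by positivity)]
  refine integral_congr_ae ?_
  have := ae_all_iff.2 fun i => (h.weak i).weakDeriv_ae_eq hU
  filter_upwards [this] with x hx
  simp only [hx, gradSq]

lemma norm1_sq (hU : IsOpen U) (h : HasGrad U u p) :
    norm1 U u ^ 2 = ∫ x in U, gradSq u p x := by
  have := h.wnorm1_sq hU fun _ => 1
  simpa [norm1] using this

lemma norm1_const_smul (hU : IsOpen U) (h : HasGrad U u p) (z : ℂ) :
    norm1 U (z • u) = ‖z‖ * norm1 U u := by
  have h1 := (h.const_smul z).norm1_sq hU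
  have h2 : ∀ x, gradSq (z • u) (z • p) x = ‖z‖ ^ 2 * gradSq u p x := by
    intro x
    simp [gradSq, mul_pow, Finset.mul_sum, mul_add]
  simp only [h2] at h1
  rw [integral_const_mul, ← h.norm1_sq hU, ← mul_pow] at h1
  exact (sq_eq_sq₀ norm1_nonneg (mul_nonneg (norm_nonneg _) norm1_nonneg)).1 h1

lemma norm1_mul_le (hU : IsOpen U) (hUΩ : U ⊆ Ω) (h : HasGrad U u p) {η : E d → ℝ}
    (hη : IsCutoff Ω η K) :
    norm1 U (fun x => (η x : ℂ) * u x) ^ 2 ≤ (1 + d * (1 + K) ^ 2) * norm1 U u ^ 2 := by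
  rw [(h.ofReal_mul hU hUΩ hη).norm1_sq hU, h.norm1_sq hU, ← integral_const_mul]
  refine setIntegral_mono_on (h.ofReal_mul hU hUΩ hη).integrable_gradSq
    (h.integrable_gradSq.const_mul _) hU.measurableSet fun x hx => ?_
  exact hη.gradSq_mul_le u p (hUΩ hx)

lemma norm1_mono (hU : IsOpen U) (hU' : IsOpen U') (hUU' : U ⊆ U') (h : HasGrad U' u p) :
    norm1 U u ≤ norm1 U' u := by
  refine (sq_le_sq₀ norm1_nonneg norm1_nonneg).1 ?_
  rw [(h.mono hUU').norm1_sq hU, h.norm1_sq hU']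
  exact setIntegral_mono_set h.integrable_gradSq
    (Eventually.of_forall fun x => gradSq_nonneg _ _ _) (Eventually.of_forall hUU')

end HasGrad

lemma IsTestFun.hasGrad (h : IsTestFun U φ) : HasGrad U φ (fun i => LocalFEM.partialDeriv i φ) :=
  ⟨h.memLp _ _, fun i => (h.partialDeriv i).memLp _ _, fun i => h.hasWeakDeriv i⟩

lemma norm1_eq_zero_of_ae_eq (hU : IsOpen U) (h : u =ᵐ[volume.restrict U] 0) : norm1 U u = 0 := by
  rw [norm1_congr h]
  have := (HasGrad.zero (U := U)).norm1_sq hU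
  simpa [gradSq] using this

namespace MemH10

lemma congr (h : MemH10 U u) (huv : u =ᵐ[volume.restrict U] v) : MemH10 U v := by
  obtain ⟨p, hp⟩ := h.1.exists_hasGrad
  refine ⟨(hp.congr huv fun i => ae_eq_refl _).memH1, fun ε hε => ?_⟩
  obtain ⟨φ, hφ, hφε⟩ := h.2 ε hε
  refine ⟨φ, hφ, ?_⟩
  rwa [← norm1_congr (u := u - φ)]
  filter_upwards [huv] with x hx
  simp [hx]

lemma zero (hU : IsOpen U) : MemH10 U (0 : E d → ℂ) :=
  ⟨HasGrad.zero.memH1, fun ε hε => ⟨0, IsTestFun.zero, by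
    rw [norm1_eq_zero_of_ae_eq hU (by simp)]; exact hε⟩⟩

lemma const_smul (hU : IsOpen U) (h : MemH10 U u) (z : ℂ) : MemH10 U (z • u) := by
  obtain ⟨p, hp⟩ := h.1.exists_hasGrad
  refine ⟨(hp.const_smul z).memH1, fun ε hε => ?_⟩
  obtain ⟨φ, hφ, hφε⟩ := h.2 (ε / (‖z‖ + 1)) (by positivity)
  refine ⟨z • φ, ⟨contDiff_const.smul hφ.1, hφ.2.1.smul_left, ?_⟩, ?_⟩
  · exact (closure_mono (Function.support_const_smul_subset z φ)).trans hφ.2.2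
  · rw [← smul_sub, (hp.sub hφ.hasGrad).norm1_const_smul hU]
    rw [lt_div_iff₀ (by positivity)] at hφε
    have := norm1_nonneg (U := U) (u := u - φ)
    nlinarith

/-- Extension by zero. -/
lemma hasGrad_indicator (hU : IsOpen U) (hΩ : IsOpen Ω) (hUΩ : U ⊆ Ω) (h : MemH10 U u)
    (hp : HasGrad U u p) : HasGrad Ω (U.indicator u) (fun i => U.indicator (p i)) := by
  have hmem : ∀ {w : E d → ℂ}, MemLp w 2 (volume.restrict U) →
      MemLp (U.indicator w) 2 (volume.restrict Ω) := fun {w} hw => by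
    have h1 : MemLp (U.indicator w) 2 volume := (memLp_indicator_iff_restrict hU.measurableSet).2 hw
    exact h1.restrict Ω
  have hint : ∀ (w ψ : E d → ℂ), ∫ x in Ω, U.indicator w x * ψ x = ∫ x in U, w x * ψ x := by
    intro w ψ
    rw [setIntegral_eq_of_subset_of_forall_sdiff_eq_zero hΩ.measurableSet hUΩ]
    · exact setIntegral_congr_fun hU.measurableSet fun x hx => by simp [indicator_of_mem hx]
    · intro x hx
      simp [hx.2]
  refine ⟨hmem hp.memLp, fun i => hmem (hp.memLp_grad i), fun i =>
    ⟨locallyIntegrableOn_of_memLp (hmem hp.memLp),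
      locallyIntegrableOn_of_memLp (hmem (hp.memLp_grad i)), fun ψ hψ => ?_⟩⟩
  rw [hint, hint, ← add_eq_zero_iff_eq_neg]
  set ψ' := partialDeriv i ψ with hψ'
  set Q : ℝ := ∫ x in U, (‖ψ' x‖ ^ 2 + ‖ψ x‖ ^ 2) with hQ
  have hQ0 : 0 ≤ Q := by positivity
  have hψL : MemLp ψ 2 (volume.restrict U) := hψ.memLp _ _
  have hψL' : MemLp ψ' 2 (volume.restrict U) := (hψ.partialDeriv i).memLp _ _
  have hint2 : ∀ {w θ : E d → ℂ}, MemLp w 2 (volume.restrict U) → MemLp θ 2 (volume.restrict U) →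
      IntegrableOn (fun x => w x * θ x) U := fun hw hθ => hw.integrable_mul hθ
  -- For test functions of `U` in place of `u` the left side vanishes. The error made by
  -- approximating `u` to within `δ` is estimated by Young's inequality with weight `δ`.
  have key : ∀ δ > 0, ‖(∫ x in U, u x * ψ' x) + ∫ x in U, p i x * ψ x‖ ≤ δ * (1 + Q) := by
    intro δ hδ
    obtain ⟨φ, hφ, hφδ⟩ := h.2 δ hδ
    have hg := hp.sub hφ.hasGrad
    have e1 := hφ.hasGrad
    have e2 : (∫ x in U, φ x * ψ' x) + ∫ x in U, partialDeriv i φ x * ψ x = 0 := by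
      have h1 := ((hφ.mono (subset_univ U)).hasWeakDeriv i).2.2 ψ (hψ.mono (subset_univ _))
      rw [Measure.restrict_univ] at h1
      rw [setIntegral_eq_integral_of_forall_compl_eq_zero,
        setIntegral_eq_integral_of_forall_compl_eq_zero, h1]
      · ring
      · intro x hx; rw [(hφ.partialDeriv i).zero_of_notMem hx, zero_mul]
      · intro x hx; rw [hφ.zero_of_notMem hx, zero_mul]
    have i1 := hint2 hp.memLp hψL'
    have i2 := hint2 (hp.memLp_grad i) hψL
    have i3 := hint2 e1.memLp hψL'
    have i4 := hint2 (e1.memLp_grad i) hψL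
    have i5 : IntegrableOn (fun x => u x * ψ' x + p i x * ψ x) U := i1.add i2
    have i6 : IntegrableOn (fun x => φ x * ψ' x + LocalFEM.partialDeriv i φ x * ψ x) U := i3.add i4
    have e3 : (∫ x in U, u x * ψ' x) + ∫ x in U, p i x * ψ x
        = ∫ x in U, ((u x - φ x) * ψ' x + (p i x - partialDeriv i φ x) * ψ x) := by
      rw [← sub_zero ((∫ x in U, u x * ψ' x) + ∫ x in U, p i x * ψ x), ← e2, ← integral_add i1 i2,
        ← integral_add i3 i4, ← integral_sub i5 i6]
      congr 1; ext x; ring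
    rw [e3]
    have hgn := hg.norm1_sq hU
    have hb : ∀ (a b : ℂ), ‖a * b‖ ≤ δ⁻¹ / 2 * ‖a‖ ^ 2 + δ / 2 * ‖b‖ ^ 2 := by
      intro a b
      rw [norm_mul]
      have h1 : 0 ≤ (δ⁻¹ / 2) * (‖a‖ - δ * ‖b‖) ^ 2 := by positivity
      have h2 : (δ⁻¹ / 2) * (‖a‖ - δ * ‖b‖) ^ 2 =
          δ⁻¹ / 2 * ‖a‖ ^ 2 + δ / 2 * ‖b‖ ^ 2 - ‖a‖ * ‖b‖ := by
        field_simp; ring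
      linarith
    have hiQ : IntegrableOn (fun x => ‖ψ' x‖ ^ 2 + ‖ψ x‖ ^ 2) U :=
      (hψL'.integrable_norm_pow (by norm_num)).add (hψL.integrable_norm_pow (by norm_num))
    calc ‖∫ x in U, ((u x - φ x) * ψ' x + (p i x - partialDeriv i φ x) * ψ x)‖
        ≤ ∫ x in U, (δ⁻¹ / 2 * (2 * gradSq (u - φ) (p - fun i => partialDeriv i φ) x)
            + δ / 2 * (‖ψ' x‖ ^ 2 + ‖ψ x‖ ^ 2)) := by
          refine norm_integral_le_of_norm_le
            (((hg.integrable_gradSq.const_mul 2).const_mul _).add (hiQ.const_mul _))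
            (Eventually.of_forall fun x => ?_)
          refine (norm_add_le _ _).trans ((add_le_add (hb _ _) (hb _ _)).trans ?_)
          have h1 := sq_norm_le_gradSq (u - φ) (p - fun i => partialDeriv i φ) x
          have h2 := sq_norm_grad_le_gradSq (u - φ) (p - fun i => partialDeriv i φ) i x
          simp only [Pi.sub_apply] at h1 h2
          have hd : 0 ≤ δ⁻¹ / 2 := by positivity
          nlinarith [mul_le_mul_of_nonneg_left h1 hd, mul_le_mul_of_nonneg_left h2 hd]
      _ = δ⁻¹ * norm1 U (u - φ) ^ 2 + δ / 2 * Q := by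
          rw [integral_add ((hg.integrable_gradSq.const_mul 2).const_mul _) (hiQ.const_mul _),
            integral_const_mul, integral_const_mul, integral_const_mul, ← hgn]
          ring
      _ ≤ δ⁻¹ * δ ^ 2 + δ * Q := by
          have := norm1_nonneg (U := U) (u := u - φ)
          gcongr
          linarith
      _ = δ * (1 + Q) := by field_simp
  have hle : ‖(∫ x in U, u x * ψ' x) + ∫ x in U, p i x * ψ x‖ ≤ 0 := by
    refine le_of_forall_pos_le_add fun ε hε => ?_
    have := key (ε / (1 + Q)) (by positivity)
    rwa [div_mul_cancel₀ _ (by positivity), ← zero_add ε] at this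
  exact norm_le_zero_iff.1 hle

lemma norm1_indicator (hU : IsOpen U) (hΩ : IsOpen Ω) (hUΩ : U ⊆ Ω) (h : MemH10 U u) :
    norm1 Ω (U.indicator u) = norm1 U u := by
  obtain ⟨p, hp⟩ := h.1.exists_hasGrad
  refine (sq_eq_sq₀ norm1_nonneg norm1_nonneg).1 ?_
  rw [(h.hasGrad_indicator hU hΩ hUΩ hp).norm1_sq hΩ, hp.norm1_sq hU,
    setIntegral_eq_of_subset_of_forall_sdiff_eq_zero hΩ.measurableSet hUΩ]
  · exact setIntegral_congr_fun hU.measurableSet fun x hx => by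
      simp only [gradSq, indicator_of_mem hx]
  · intro x hx
    simp [gradSq, hx.2]

lemma sub_testFun (h : MemH10 U u) (hφ : IsTestFun U φ) : MemH10 U (u - φ) := by
  obtain ⟨p, hp⟩ := h.1.exists_hasGrad
  refine ⟨(hp.sub hφ.hasGrad).memH1, fun ε hε => ?_⟩
  obtain ⟨ψ, hψ, hlt⟩ := h.2 ε hε
  refine ⟨ψ - φ, ⟨hψ.1.sub hφ.1, hψ.2.1.sub hφ.2.1, ?_⟩, by simpa using hlt⟩
  exact (tsupport_sub ψ φ).trans (union_subset hψ.2.2 hφ.2.2)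

lemma indicator (hU : IsOpen U) (hΩ : IsOpen Ω) (hUΩ : U ⊆ Ω) (h : MemH10 U u) :
    MemH10 Ω (U.indicator u) := by
  obtain ⟨p, hp⟩ := h.1.exists_hasGrad
  refine ⟨(h.hasGrad_indicator hU hΩ hUΩ hp).memH1, fun ε hε => ?_⟩
  obtain ⟨φ, hφ, hφε⟩ := h.2 ε hε
  refine ⟨φ, hφ.mono hUΩ, ?_⟩
  have : U.indicator u - φ = U.indicator (u - φ) := by
    funext x
    by_cases hx : x ∈ U
    · simp [hx]
    · simp [hx, hφ.zero_of_notMem hx]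
  rwa [this, (h.sub_testFun hφ).norm1_indicator hU hΩ hUΩ]

/-- A function in `H¹₀(Ω)` that is reproduced by a cut-off with support inside `U`
belongs to `H¹₀(U)`. -/
lemma of_cutoff (hU : IsOpen U) (hΩ : IsOpen Ω) (hUΩ : U ⊆ Ω) (h : MemH10 Ω u) {η : E d → ℝ}
    (hη : IsCutoff Ω η K) (hsupp : Ω ∩ tsupport η ⊆ U) (hηu : ∀ x ∈ U, (η x : ℂ) * u x = u x) :
    MemH10 U u := by
  obtain ⟨p, hp⟩ := h.1.exists_hasGrad
  refine ⟨(hp.mono hUΩ).memH1, fun ε hε => ?_⟩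
  set C : ℝ := 1 + d * (1 + K) ^ 2 with hC
  have hC1 : 0 < C := by positivity
  -- Multiplication by `η` turns `φ` into a test function of `U` and fixes `u` on `U`; it enlarges
  -- the error by at most `√C`.
  obtain ⟨φ, hφ, hφε⟩ := h.2 (ε / √C) (by positivity)
  have hφη := hφ.ofReal_mul hη.contDiff
  refine ⟨_, ⟨hφη.1, hφη.2.1, fun x hx => hsupp ⟨hφη.2.2 hx, ?_⟩⟩, ?_⟩
  · refine closure_mono (fun y hy => ?_) hx
    exact fun h0 => hy (by simp [h0])
  · have hg := (hp.sub hφ.hasGrad).mono hUΩ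
    have e : norm1 U (u - fun x => (η x : ℂ) * φ x) =
        norm1 U (fun x => (η x : ℂ) * (u - φ) x) := by
      refine norm1_congr ?_
      filter_upwards [ae_restrict_mem hU.measurableSet] with x hx
      simp only [Pi.sub_apply, mul_sub, hηu x hx]
    have h1 := hg.norm1_mul_le hU hUΩ hη
    rw [← e, ← hC] at h1
    have h2 := (hp.sub hφ.hasGrad).norm1_mono hU hΩ hUΩ
    have h3 : norm1 U (u - φ) < ε / √C := h2.trans_lt hφε
    refine lt_of_pow_lt_pow_left₀ 2 hε.le (h1.trans_lt ?_)
    have h4 : norm1 U (u - φ) ^ 2 < (ε / √C) ^ 2 := pow_lt_pow_left₀ h3 norm1_nonneg (by norm_num)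
    rw [div_pow, Real.sq_sqrt hC1.le, lt_div_iff₀ hC1] at h4
    linarith

end MemH10

lemma normNeg1_nonneg (f : (E d → ℂ) → ℂ) : 0 ≤ normNeg1 U f :=
  Real.sSup_nonneg fun _ ⟨_, _, _, hr⟩ => hr ▸ norm_nonneg _

namespace MemHneg1

variable {f : (E d → ℂ) → ℂ}

/-- `f` acts on functions, not on classes. Its boundedness makes it vanish on `v - u`, which has
norm zero, and additivity gives the rest. -/
lemma congr (hΩ : IsOpen Ω) (hf : MemHneg1 Ω f) (hu : MemH10 Ω u)
    (huv : u =ᵐ[volume.restrict Ω] v) : f v = f u := by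
  obtain ⟨hadd, -, B, hB⟩ := hf
  have h0 : v - u =ᵐ[volume.restrict Ω] 0 := by
    filter_upwards [huv] with x hx
    simp [hx]
  have hm : MemH10 Ω (v - u) := (MemH10.zero hΩ).congr h0.symm
  have h1 := hB _ hm
  rw [norm1_eq_zero_of_ae_eq hΩ h0, mul_zero, norm_le_zero_iff] at h1
  have h2 := hadd u (v - u) hu hm
  rw [add_sub_cancel, h1, add_zero] at h2
  exact h2

lemma norm_le (hU : IsOpen U) (hΩ : IsOpen Ω) (hUΩ : U ⊆ Ω) (hf : MemHneg1 Ω f)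
    (hu : MemH10 U u) (h0 : ∀ x ∈ Ω, x ∉ U → u x = 0) :
    ‖f u‖ ≤ normNeg1 U f * norm1 U u := by
  have hext := hu.indicator hU hΩ hUΩ
  have hfu : f u = f (U.indicator u) := by
    refine hf.congr hΩ hext ?_
    filter_upwards [ae_restrict_mem hΩ.measurableSet] with x hx
    by_cases hxU : x ∈ U
    · simp [hxU]
    · simp [hxU, h0 x hx hxU]
  obtain ⟨-, hsmul, B, hB⟩ := hf
  rw [hfu]
  obtain ⟨p, hp⟩ := hu.1.exists_hasGrad
  -- A function of norm zero cannot be normalised; the bound of `f` on `H¹₀(Ω)` covers it.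
  rcases (norm1_nonneg (U := U) (u := u)).eq_or_lt with hn | hn
  · have := hB _ hext
    rw [hu.norm1_indicator hU hΩ hUΩ] at this
    rw [← hn] at this ⊢
    simpa using this
  · set z : ℂ := (((norm1 U u)⁻¹ : ℝ) : ℂ) with hz
    have hzn : ‖z‖ = (norm1 U u)⁻¹ := by
      rw [hz, Complex.norm_real, Real.norm_of_nonneg (by positivity)]
    have hmem : ‖f (U.indicator (z • u))‖ ∈
        {r : ℝ | ∃ φ, MemH10 U φ ∧ norm1 U φ = 1 ∧ r = ‖f (U.indicator φ)‖} := by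
      refine ⟨z • u, hu.const_smul hU z, ?_, rfl⟩
      rw [hp.norm1_const_smul hU, hzn, inv_mul_cancel₀ hn.ne']
    -- Without a bound the real supremum would be `0`; the global bound of `f` provides one, as
    -- extension by zero preserves the norm.
    have hbdd : BddAbove {r : ℝ | ∃ φ, MemH10 U φ ∧ norm1 U φ = 1 ∧ r = ‖f (U.indicator φ)‖} := by
      refine ⟨B, ?_⟩
      rintro r ⟨φ, hφ, hφ1, rfl⟩
      have := hB _ (hφ.indicator hU hΩ hUΩ)
      rwa [hφ.norm1_indicator hU hΩ hUΩ, hφ1, mul_one] at this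
    have h1 : ‖f (U.indicator (z • u))‖ ≤ normNeg1 U f := le_csSup hbdd hmem
    have h2 : U.indicator (z • u) = z • U.indicator u := by
      funext x
      by_cases hx : x ∈ U <;> simp [hx]
    rw [h2, hsmul z _ hext, norm_mul, RCLike.norm_conj, hzn, inv_mul_le_iff₀ hn] at h1
    linarith

end MemHneg1

end SobolevNorms

/-! ### Pointwise bounds for the form, and the local energy estimate. -/

section SesquilinearForm

open Filter Topology Set

variable {d : ℕ} {U D Ω Ω₀ : Set (E d)} {u v w z : E d → ℂ} {p q r : Fin d → E d → ℂ} {K M a₀ : ℝ}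

namespace Coeffs

variable (L : Coeffs d)

/-- The integrand of the sesquilinear form; `p` and `q` stand for the gradients of `u` and `v`. -/
def integrand (u : E d → ℂ) (p : Fin d → E d → ℂ) (v : E d → ℂ) (q : Fin d → E d → ℂ) (x : E d) :
    ℂ :=
  (∑ i, ∑ j, L.a i j x * p i x * conj (q j x))
    + (∑ i, L.b i x * p i x * conj (v x)) + L.c x * u x * conj (v x)

/-- All coefficients are bounded by `M` at `x`. -/
def BoundedAt (M : ℝ) (x : E d) : Prop :=
  (∀ i j, ‖L.a i j x‖ ≤ M) ∧ (∀ i, ‖L.b i x‖ ≤ M) ∧ ‖L.c x‖ ≤ M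

variable {L}

lemma form_eq (hU : IsOpen U) (hu : HasGrad U u p) (hv : HasGrad U v q) :
    L.form U u v = ∫ x in U, L.integrand u p v q x := by
  unfold form integrand
  refine integral_congr_ae ?_
  have h1 := ae_all_iff.2 fun i => (hu.weak i).weakDeriv_ae_eq hU
  have h2 := ae_all_iff.2 fun i => (hv.weak i).weakDeriv_ae_eq hU
  filter_upwards [h1, h2] with x hx1 hx2
  simp only [hx1, hx2]

lemma integrand_sub_right (x : E d) :
    L.integrand w p (u - v) (q - r) x = L.integrand w p u q x - L.integrand w p v r x := by
  simp only [integrand, Pi.sub_apply, map_sub, mul_sub, Finset.sum_sub_distrib]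
  ring

lemma integrand_eq_zero_right {x : E d} (hv : v x = 0) (hq : ∀ i, q i x = 0) :
    L.integrand u p v q x = 0 := by
  simp [integrand, hv, hq]

lemma norm_integrand_le {x : E d} (hM : 0 ≤ M) (h : L.BoundedAt M x) :
    ‖L.integrand u p v q x‖ ≤
      M * (d ^ 2 + d + 1) * (√(gradSq u p x) * √(gradSq v q x)) := by
  set s := √(gradSq u p x)
  set t := √(gradSq v q x)
  have hs : 0 ≤ s := Real.sqrt_nonneg _
  have ht : 0 ≤ t := Real.sqrt_nonneg _
  have key : ∀ {a b c : ℂ}, ‖a‖ ≤ M → ‖b‖ ≤ s → ‖c‖ ≤ t → ‖a * b * conj c‖ ≤ M * (s * t) := by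
    intro a b c ha hb hc
    rw [norm_mul, norm_mul, RCLike.norm_conj, mul_assoc]
    gcongr
  have h1 : ‖∑ i, ∑ j, L.a i j x * p i x * conj (q j x)‖ ≤ ∑ _i : Fin d, ∑ _j : Fin d, M * (s * t) :=
    norm_sum_le_of_le _ fun i _ => norm_sum_le_of_le _ fun j _ =>
      key (h.1 i j) (norm_grad_le_sqrt_gradSq u p i x) (norm_grad_le_sqrt_gradSq v q j x)
  have h2 : ‖∑ i, L.b i x * p i x * conj (v x)‖ ≤ ∑ _i : Fin d, M * (s * t) :=
    norm_sum_le_of_le _ fun i _ =>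
      key (h.2.1 i) (norm_grad_le_sqrt_gradSq u p i x) (norm_le_sqrt_gradSq v q x)
  have h3 := key h.2.2 (norm_le_sqrt_gradSq u p x) (norm_le_sqrt_gradSq v q x)
  simp only [Finset.sum_const, Finset.card_univ, Fintype.card_fin, nsmul_eq_mul] at h1 h2
  refine (norm_add₃_le).trans ((add_le_add (add_le_add h1 h2) h3).trans (le_of_eq ?_))
  ring

/-- Young's inequality for the integrand. -/
lemma norm_integrand_le_young {x : E d} (hM : 0 ≤ M) (h : L.BoundedAt M x) {t : ℝ} (ht : 0 < t) :
    ‖L.integrand u p v q x‖ ≤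
      M * (d ^ 2 + d + 1) * (t * gradSq u p x + t⁻¹ * gradSq v q x) := by
  refine (norm_integrand_le hM h).trans ?_
  gcongr
  have h1 := Real.sq_sqrt (gradSq_nonneg u p x)
  have h2 := Real.sq_sqrt (gradSq_nonneg v q x)
  rw [← h1, ← h2, Real.sqrt_sq (Real.sqrt_nonneg _), Real.sqrt_sq (Real.sqrt_nonneg _)]
  set s := √(gradSq u p x)
  set s' := √(gradSq v q x)
  have h3 : 0 ≤ t * (s - t⁻¹ * s' / 2) ^ 2 := by positivity
  have h4 : t * (s - t⁻¹ * s' / 2) ^ 2 = t * s ^ 2 - s * s' + t⁻¹ * s' ^ 2 / 4 := by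
    field_simp; ring
  have h5 : 0 ≤ t⁻¹ * s' ^ 2 := by positivity
  linarith

/-- The principal parts cancel, and so do the terms with `c`; what is left carries a derivative of
`η` next to an undifferentiated `w`. The bound involves the gradient of `u = η w` and not that of
`w`, which is what allows it to be absorbed. -/
lemma norm_integrand_commutator_le {x : E d} (hM : 0 ≤ M) (h : L.BoundedAt M x)
    {η : E d → ℝ} (hη : IsCutoff Ω η K) (hx : x ∈ Ω)
    (hu : u = fun x => (η x : ℂ) * w x) (hq : q = mulGrad η w p) :
    ‖L.integrand u q u q x
        - L.integrand w p (fun x => (η x : ℂ) * u x) (mulGrad η u q) x‖ ≤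
      M * ((2 * d ^ 2 * K + d * K) * (‖w x‖ * √(gradSq u q x)) + d ^ 2 * K ^ 2 * ‖w x‖ ^ 2) := by
  set s := √(gradSq u q x)
  have hs : 0 ≤ s := Real.sqrt_nonneg _
  have hK := hη.nonneg
  set η' : Fin d → ℝ := fun i => fderiv ℝ η x (EuclideanSpace.single i 1) with hη'
  have hη'K : ∀ i, ‖(η' i : ℂ)‖ ≤ K := fun i => by
    rw [Complex.norm_real]; exact hη.deriv_le x hx i
  -- The gradient `p` of `w` enters only through `η p`, which this relation eliminates.
  have e1 : ∀ i, (η x : ℂ) * p i x = q i x - (η' i : ℂ) * w x := fun i => by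
    rw [hq]; simp [mulGrad, hη']
  have e2 : u x = (η x : ℂ) * w x := by rw [hu]
  have hdiff : L.integrand u q u q x
        - L.integrand w p (fun x => (η x : ℂ) * u x) (mulGrad η u q) x =
      (∑ i, ∑ j, L.a i j x * ((η' i : ℂ) * w x * conj (q j x) - q i x * (η' j : ℂ) * conj (w x)
        + (η' i : ℂ) * (η' j : ℂ) * (w x * conj (w x))))
      + ∑ i, L.b i x * ((η' i : ℂ) * w x * conj (u x)) := by
    have ha : ∀ i j, L.a i j x * q i x * conj (q j x) - L.a i j x * p i x * conj (mulGrad η u q j x)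
        = L.a i j x * ((η' i : ℂ) * w x * conj (q j x) - q i x * (η' j : ℂ) * conj (w x)
        + (η' i : ℂ) * (η' j : ℂ) * (w x * conj (w x))) := by
      intro i j
      have : mulGrad η u q j x = (η x : ℂ) * q j x + (η' j : ℂ) * u x := rfl
      rw [this, e2]
      simp only [map_add, map_mul, Complex.conj_ofReal]
      linear_combination (-(L.a i j x) * conj (q j x) - L.a i j x * (η' j : ℂ) * conj (w x)) * e1 i
    have hb : ∀ i, L.b i x * q i x * conj (u x) - L.b i x * p i x * conj ((η x : ℂ) * u x)
        = L.b i x * ((η' i : ℂ) * w x * conj (u x)) := by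
      intro i
      simp only [map_mul, Complex.conj_ofReal]
      linear_combination (-(L.b i x) * conj (u x)) * e1 i
    have hc : L.c x * u x * conj (u x) - L.c x * w x * conj ((η x : ℂ) * u x) = 0 := by
      simp only [map_mul, Complex.conj_ofReal]
      rw [e2]; ring
    simp only [← ha, ← hb, Finset.sum_sub_distrib, integrand]
    linear_combination hc
  rw [hdiff]
  have h1 : ‖∑ i, ∑ j, L.a i j x * ((η' i : ℂ) * w x * conj (q j x) - q i x * (η' j : ℂ) * conj (w x)
        + (η' i : ℂ) * (η' j : ℂ) * (w x * conj (w x)))‖ ≤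
      ∑ _i : Fin d, ∑ _j : Fin d, M * (K * ‖w x‖ * s + s * K * ‖w x‖ + K * K * (‖w x‖ * ‖w x‖)) := by
    refine norm_sum_le_of_le _ fun i _ => norm_sum_le_of_le _ fun j _ => ?_
    rw [norm_mul]
    have h2 := h.1 i j
    have h3 := norm_grad_le_sqrt_gradSq u q i x
    have h4 := norm_grad_le_sqrt_gradSq u q j x
    have h5 := hη'K i
    have h6 := hη'K j
    gcongr
    refine (norm_add_le _ _).trans (add_le_add ((norm_sub_le _ _).trans (add_le_add ?_ ?_)) ?_)
    · rw [norm_mul, norm_mul, RCLike.norm_conj]; gcongr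
    · rw [norm_mul, norm_mul, RCLike.norm_conj]; gcongr
    · rw [norm_mul, norm_mul, norm_mul, RCLike.norm_conj]; gcongr
  have h2 : ‖∑ i, L.b i x * ((η' i : ℂ) * w x * conj (u x))‖ ≤ ∑ _i : Fin d, M * (K * ‖w x‖ * s) := by
    refine norm_sum_le_of_le _ fun i _ => ?_
    rw [norm_mul, norm_mul, norm_mul, RCLike.norm_conj]
    have h2 := h.2.1 i
    have h3 := norm_le_sqrt_gradSq u q x
    have h5 := hη'K i
    gcongr
  simp only [Finset.sum_const, Finset.card_univ, Fintype.card_fin, nsmul_eq_mul] at h1 h2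
  refine (norm_add_le _ _).trans ((add_le_add h1 h2).trans (le_of_eq ?_))
  ring

lemma integrableOn_integrand (hU : U ⊆ Ω) (hadm : L.Admissible Ω a₀) (hM : 0 ≤ M)
    (hb : ∀ᵐ x ∂volume.restrict Ω, L.BoundedAt M x)
    (hu : HasGrad U u p) (hv : HasGrad U v q) : IntegrableOn (L.integrand u p v q) U := by
  have hr : volume.restrict U ≤ volume.restrict Ω := Measure.restrict_mono hU le_rfl
  have hconj : ∀ {g : E d → ℂ}, MemLp g 2 (volume.restrict U) →
      AEStronglyMeasurable (fun x => conj (g x)) (volume.restrict U) := fun hg =>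
    Complex.continuous_conj.comp_aestronglyMeasurable hg.aestronglyMeasurable
  have hm : ∀ {g g₁ g₂ : E d → ℂ}, MemLinfty Ω g → MemLp g₁ 2 (volume.restrict U) →
      MemLp g₂ 2 (volume.restrict U) →
      AEStronglyMeasurable (fun x => g x * g₁ x * conj (g₂ x)) (volume.restrict U) :=
    fun hg h1 h2 =>
      ((hg.aestronglyMeasurable.mono_measure hr).mul h1.aestronglyMeasurable).mul (hconj h2)
  refine Integrable.mono' (g := fun x => M * (d ^ 2 + d + 1) *
    ((1 : ℝ) * gradSq u p x + (1 : ℝ)⁻¹ * gradSq v q x)) ?_ ?_ ?_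
  · exact ((hu.integrable_gradSq.const_mul _).add (hv.integrable_gradSq.const_mul _)).const_mul _
  · refine AEStronglyMeasurable.add (AEStronglyMeasurable.add ?_ ?_) ?_
    · exact Finset.aestronglyMeasurable_fun_sum _ fun i _ =>
        Finset.aestronglyMeasurable_fun_sum _ fun j _ =>
          hm (hadm.mem_a i j).1 (hu.memLp_grad i) (hv.memLp_grad j)
    · exact Finset.aestronglyMeasurable_fun_sum _ fun i _ =>
        hm (hadm.mem_b i).1 (hu.memLp_grad i) hv.memLp
    · exact hm hadm.mem_c hu.memLp hv.memLp
  · filter_upwards [ae_restrict_of_subset hb hU] with x hx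
    exact norm_integrand_le_young hM hx one_pos

lemma Admissible.exists_bound (h : L.Admissible Ω a₀) :
    ∃ M, 0 ≤ M ∧ ∀ᵐ x ∂volume.restrict Ω, L.BoundedAt M x := by
  have key : ∀ {g : E d → ℂ}, MemLinfty Ω g →
      ∃ N : ℝ, 0 ≤ N ∧ ∀ᵐ x ∂volume.restrict Ω, ‖g x‖ ≤ N := by
    intro g hg
    have h1 := ae_le_eLpNormEssSup (f := g) (μ := volume.restrict Ω)
    have h2 := hg.eLpNorm_lt_top
    rw [eLpNorm_exponent_top] at h2
    refine ⟨(eLpNormEssSup g (volume.restrict Ω)).toReal, ENNReal.toReal_nonneg, ?_⟩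
    filter_upwards [h1] with x hx
    rw [← toReal_enorm]
    exact ENNReal.toReal_mono h2.ne hx
  choose A hA0 hA using fun i j => key (h.mem_a i j).1
  choose B hB0 hB using fun i => key (h.mem_b i).1
  obtain ⟨N, hN0, hN⟩ := key h.mem_c
  have hAs : 0 ≤ ∑ i, ∑ j, A i j := Finset.sum_nonneg fun i _ => Finset.sum_nonneg fun j _ => hA0 i j
  have hBs : 0 ≤ ∑ i, B i := Finset.sum_nonneg fun i _ => hB0 i
  refine ⟨(∑ i, ∑ j, A i j) + ∑ i, B i + N, by positivity, ?_⟩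
  filter_upwards [ae_all_iff.2 fun i => ae_all_iff.2 (hA i), ae_all_iff.2 hB, hN] with x hx1 hx2 hx3
  refine ⟨fun i j => (hx1 i j).trans ?_, fun i => (hx2 i).trans ?_, by linarith⟩
  · have h3 : A i j ≤ ∑ j, A i j :=
      Finset.single_le_sum (fun j _ => hA0 i j) (Finset.mem_univ j)
    have h4 : ∑ j, A i j ≤ ∑ i, ∑ j, A i j :=
      Finset.single_le_sum (f := fun i => ∑ j, A i j)
        (fun i _ => Finset.sum_nonneg fun j _ => hA0 i j) (Finset.mem_univ i)
    linarith
  · have h3 : B i ≤ ∑ i, B i := Finset.single_le_sum (fun i _ => hB0 i) (Finset.mem_univ i)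
    linarith

/-- Local energy estimate: the energy of `η w` is controlled by lower-order terms, by the
approximation error `η² w - v` and by the residual `a(w, v)`. -/
lemma Admissible.local_energy (hΩ : IsOpen Ω) (hΩ₀ : IsOpen Ω₀) (hD : IsOpen D) (hDΩ₀ : D ⊆ Ω₀)
    (hΩ₀Ω : Ω₀ ⊆ Ω) (hadm : L.Admissible Ω a₀) {η : E d → ℝ} (hη : IsCutoff Ω η K)
    (hη0 : ∀ x ∈ Ω, x ∉ D → η =ᶠ[𝓝 x] 0) :
    ∃ C > 0, ∀ (w v : E d → ℂ) (p q : Fin d → E d → ℂ), HasGrad Ω w p → HasGrad Ω v q →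
      (∀ x ∈ Ω, x ∉ D → v x = 0 ∧ ∀ i, q i x = 0) → ∀ t > 0,
      norm1 D (fun x => (η x : ℂ) * w x) ^ 2 ≤ C * (norm0 D w ^ 2 + t * norm1 D w ^ 2 +
        t⁻¹ * norm1 D (fun x => (η x : ℂ) * ((η x : ℂ) * w x) - v x) ^ 2 +
        ‖L.form Ω₀ w v‖) := by
  obtain ⟨M, hM, hb⟩ := hadm.exists_bound
  have ha₀ := hadm.pos
  have hDΩ := hDΩ₀.trans hΩ₀Ω
  have hK := hη.nonneg
  set κ₁ : ℝ := 2 * d ^ 2 * K + d * K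
  set κ₂ : ℝ := d ^ 2 * K ^ 2
  -- `C₁` is what remains of the commutator after Young's inequality has moved `a₀ / 4` times the
  -- energy to the left, half of the coercivity constant.
  set C₁ : ℝ := (M * κ₁) ^ 2 / a₀ + M * κ₂ with hC₁
  set C₂ : ℝ := M * (d ^ 2 + d + 1) with hC₂
  have hκ₂ : 0 ≤ κ₂ := by positivity
  have hC₁0 : 0 ≤ C₁ := by positivity
  have hC₂0 : 0 ≤ C₂ := by positivity
  refine ⟨4 / a₀ * (C₁ + C₂ + 1), by positivity, fun w v p q hw hv hv0 t ht => ?_⟩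
  set u : E d → ℂ := fun x => (η x : ℂ) * w x with hu
  set g := mulGrad η w p with hg
  set z : E d → ℂ := fun x => (η x : ℂ) * u x with hz
  set zg := mulGrad η u g with hzg
  have hug : HasGrad Ω u g := hw.ofReal_mul hΩ subset_rfl hη
  have hzg' : HasGrad Ω z zg := hug.ofReal_mul hΩ subset_rfl hη
  have hr : HasGrad Ω (z - v) (zg - q) := hzg'.sub hv
  have hu0 : ∀ x ∈ Ω, x ∉ D → u x = 0 ∧ ∀ i, g i x = 0 := by
    intro x hx hxD
    have h1 : η x = 0 := (hη0 x hx hxD).eq_of_nhds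
    have h2 : fderiv ℝ η x = 0 := by
      rw [(hη0 x hx hxD).fderiv_eq]; simp
    exact ⟨by simp [hu, h1], fun i => by simp [hg, mulGrad, h1, h2]⟩
  have hint : ∀ {y y' : E d → ℂ} {s s' : Fin d → E d → ℂ}, HasGrad Ω y s → HasGrad Ω y' s' →
      IntegrableOn (L.integrand y s y' s') D := fun h h' =>
    integrableOn_integrand hDΩ hadm hM hb (h.mono hDΩ) (h'.mono hDΩ)
  have hco := hadm.coercive u hug.memH1
  have hX := (hug.mono hDΩ).norm1_sq hD
  -- Coercivity is available only on all of `Ω`; since `u` and its gradient vanish off `D`, it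
  -- localises.
  have hX' : norm1 Ω u ^ 2 = norm1 D u ^ 2 := by
    rw [hX, hug.norm1_sq hΩ,
      setIntegral_eq_of_subset_of_forall_sdiff_eq_zero hΩ.measurableSet hDΩ]
    intro x hx
    simp [gradSq, (hu0 x hx.1 hx.2).1, (hu0 x hx.1 hx.2).2]
  have hform : L.form Ω u u = ∫ x in D, L.integrand u g u g x := by
    rw [form_eq hΩ hug hug,
      setIntegral_eq_of_subset_of_forall_sdiff_eq_zero hΩ.measurableSet hDΩ]
    intro x hx
    exact integrand_eq_zero_right (hu0 x hx.1 hx.2).1 (hu0 x hx.1 hx.2).2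
  have hF : L.form Ω₀ w v = ∫ x in D, L.integrand w p v q x := by
    rw [form_eq hΩ₀ (hw.mono hΩ₀Ω) (hv.mono hΩ₀Ω),
      setIntegral_eq_of_subset_of_forall_sdiff_eq_zero hΩ₀.measurableSet hDΩ₀]
    intro x hx
    exact integrand_eq_zero_right (hv0 x (hΩ₀Ω hx.1) hx.2).1 (hv0 x (hΩ₀Ω hx.1) hx.2).2
  -- `a(ηw, ηw)` is the sum of the commutator, of `a(w, η²w - v)` and of the residual `a(w, v)`.
  have hsplit : ∫ x in D, L.integrand u g u g x =
      (∫ x in D, (L.integrand u g u g x - L.integrand w p z zg x))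
        + (∫ x in D, L.integrand w p (z - v) (zg - q) x) + L.form Ω₀ w v := by
    rw [hF, integral_sub (hint hug hug) (hint hw hzg')]
    simp only [integrand_sub_right]
    rw [integral_sub (hint hw hzg') (hint hw hv)]
    ring
  have hmemD : ∀ᵐ x ∂volume.restrict D, x ∈ D ∧ L.BoundedAt M x :=
    (ae_restrict_mem hD.measurableSet).and (ae_restrict_of_subset hb hDΩ)
  have hwint : IntegrableOn (fun x => ‖w x‖ ^ 2) D :=
    (hw.mono hDΩ).memLp.integrable_norm_pow (by norm_num)
  have hY : norm0 D w ^ 2 = ∫ x in D, ‖w x‖ ^ 2 := by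
    unfold norm0 wnorm0
    rw [Real.sq_sqrt (by positivity)]
    simp
  have b1 : ‖∫ x in D, (L.integrand u g u g x - L.integrand w p z zg x)‖ ≤
      a₀ / 4 * norm1 D u ^ 2 + C₁ * norm0 D w ^ 2 := by
    rw [hX, hY, ← integral_const_mul, ← integral_const_mul,
      ← integral_add ((hug.mono hDΩ).integrable_gradSq.const_mul _) (hwint.const_mul _)]
    refine norm_integral_le_of_norm_le
      (((hug.mono hDΩ).integrable_gradSq.const_mul _).add (hwint.const_mul _)) ?_
    filter_upwards [hmemD] with x hx
    refine (norm_integrand_commutator_le hM hx.2 hη (hDΩ hx.1) hu hg).trans ?_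
    have h1 := Real.sq_sqrt (gradSq_nonneg u g x)
    rw [← h1, Real.sqrt_sq (Real.sqrt_nonneg _)]
    set s := √(gradSq u g x)
    have h2 : 0 ≤ a₀⁻¹ * (a₀ / 2 * s - M * κ₁ * ‖w x‖) ^ 2 := by positivity
    have h3 : a₀⁻¹ * (a₀ / 2 * s - M * κ₁ * ‖w x‖) ^ 2
        = a₀ / 4 * s ^ 2 - M * κ₁ * (‖w x‖ * s) + (M * κ₁) ^ 2 / a₀ * ‖w x‖ ^ 2 := by
      field_simp; ring
    rw [hC₁]
    linarith
  have b2 : ‖∫ x in D, L.integrand w p (z - v) (zg - q) x‖ ≤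
      C₂ * (t * norm1 D w ^ 2 + t⁻¹ * norm1 D (z - v) ^ 2) := by
    rw [(hw.mono hDΩ).norm1_sq hD, (hr.mono hDΩ).norm1_sq hD, ← integral_const_mul,
      ← integral_const_mul, ← integral_add ((hw.mono hDΩ).integrable_gradSq.const_mul _)
        ((hr.mono hDΩ).integrable_gradSq.const_mul _), ← integral_const_mul]
    refine norm_integral_le_of_norm_le ((((hw.mono hDΩ).integrable_gradSq.const_mul _).add
        ((hr.mono hDΩ).integrable_gradSq.const_mul _)).const_mul _) ?_
    filter_upwards [hmemD] with x hx
    exact norm_integrand_le_young hM hx.2 ht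
  rw [hform, hsplit, hX', Complex.add_re, Complex.add_re] at hco
  have r1 := Complex.re_le_norm (∫ x in D, (L.integrand u g u g x - L.integrand w p z zg x))
  have r2 := Complex.re_le_norm (∫ x in D, L.integrand w p (z - v) (zg - q) x)
  have r3 := Complex.re_le_norm (L.form Ω₀ w v)
  have hfin : a₀ / 4 * norm1 D u ^ 2 ≤ (C₁ + C₂ + 1) * (norm0 D w ^ 2 + t * norm1 D w ^ 2 +
      t⁻¹ * norm1 D (z - v) ^ 2 + ‖L.form Ω₀ w v‖) := by
    have n1 : 0 ≤ norm0 D w ^ 2 := by positivity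
    have n2 : 0 ≤ t * norm1 D w ^ 2 := by positivity
    have n3 : 0 ≤ t⁻¹ * norm1 D (z - v) ^ 2 := by positivity
    have n4 : 0 ≤ ‖L.form Ω₀ w v‖ := norm_nonneg _
    have m1 := mul_nonneg hC₁0 n2
    have m2 := mul_nonneg hC₁0 n3
    have m3 := mul_nonneg hC₁0 n4
    have m4 := mul_nonneg hC₂0 n1
    have m5 := mul_nonneg hC₂0 n4
    nlinarith
  calc norm1 D u ^ 2 = 4 / a₀ * (a₀ / 4 * norm1 D u ^ 2) := by field_simp
    _ ≤ 4 / a₀ * ((C₁ + C₂ + 1) * (norm0 D w ^ 2 + t * norm1 D w ^ 2 +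
      t⁻¹ * norm1 D (z - v) ^ 2 + ‖L.form Ω₀ w v‖)) := by gcongr
    _ = _ := by rw [← mul_assoc]; rfl

end Coeffs

end SesquilinearForm

/-! ### Finite element functions and the mesh-size function. -/

section FiniteElements

open Filter Topology Set

variable {d : ℕ} {U D Ω Ω₀ G : Set (E d)} {u v w : E d → ℂ} {p q : Fin d → E d → ℂ}

/-- The function and its classical derivatives are bounded on the bounded set `Ω`. With classical
derivatives as the gradient, the gradient vanishes pointwise wherever the function vanishes locally.
-/
lemma IsFESpace.hasGrad (hΩ : IsOpen Ω) (hb : Bornology.IsBounded Ω) {T : Mesh Ω}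
    {V : Submodule ℂ (E d → ℂ)} (hV : IsFESpace T V) (hv : v ∈ V) :
    HasGrad Ω v (fun i => partialDeriv i v) := by
  obtain ⟨L, hL0, hL⟩ := hV.exists_lipschitz_segment hb hv
  have hL' : ∀ x y, segment ℝ x y ⊆ Ω → ‖v x - v y‖ ≤ L * ‖x - y‖ := fun x y h =>
    hL x y (h.trans subset_closure)
  have hc := (hV v hv).1
  have : IsFiniteMeasure (volume.restrict Ω) :=
    ⟨by rw [Measure.restrict_apply_univ]; exact hb.measure_lt_top⟩
  obtain ⟨B, hB⟩ := hb.isCompact_closure.exists_bound_of_continuousOn hc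
  refine ⟨?_, fun i => ?_, fun i => hasWeakDeriv_of_lipschitz_segment hΩ hL0
    (hc.mono subset_closure) hL' (hV.ae_differentiableAt hv) i⟩
  · refine MemLp.of_bound ((hc.mono subset_closure).aestronglyMeasurable hΩ.measurableSet) B ?_
    filter_upwards [ae_restrict_mem hΩ.measurableSet] with x hx using hB x (subset_closure hx)
  · refine MemLp.of_bound (measurable_fderiv_apply_const ℝ v _).aestronglyMeasurable L ?_
    filter_upwards [ae_restrict_mem hΩ.measurableSet] with x hx
    exact norm_partialDeriv_le_of_lipschitz_segment hΩ hL0 hL' hx i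

namespace Mesh

variable (T : Mesh Ω)

lemma finite_diams (x : E d) : (Metric.diam '' {τ | τ ∈ T.elems ∧ x ∈ τ}).Finite :=
  (T.elems.finite_toSet.subset fun _ h => h.1).image _

lemma diam_le_size {x : E d} {τ : Set (E d)} (hτ : τ ∈ T.elems) (hx : x ∈ τ) :
    Metric.diam τ ≤ T.size x :=
  le_csSup (T.finite_diams x).bddAbove ⟨τ, ⟨hτ, hx⟩, rfl⟩

lemma diam_pos (hd : 0 < d) {τ : Set (E d)} (hτ : τ ∈ T.elems) : 0 < Metric.diam τ := by
  obtain ⟨x, hx⟩ := T.interior_nonempty τ hτ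
  have : Nonempty (Fin d) := ⟨⟨0, hd⟩⟩
  have hinf : τ.Infinite := infinite_of_mem_nhds x (mem_interior_iff_mem_nhds.1 hx)
  exact Metric.diam_pos hinf.nontrivial (T.isCompact τ hτ).isBounded

lemma size_pos (hd : 0 < d) {x : E d} (hx : x ∈ Ω) : 0 < T.size x := by
  have h := subset_closure hx
  rw [← T.cover] at h
  simp only [mem_iUnion, exists_prop] at h
  obtain ⟨τ, hτ, hxτ⟩ := h
  exact (T.diam_pos hd hτ).trans_le (T.diam_le_size hτ hxτ)

lemma size_le_diam (hb : Bornology.IsBounded Ω) (x : E d) : T.size x ≤ Metric.diam (closure Ω) := by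
  refine Real.sSup_le ?_ Metric.diam_nonneg
  rintro _ ⟨τ, ⟨hτ, -⟩, rfl⟩
  exact Metric.diam_mono (T.cover ▸ subset_biUnion_of_mem (u := id) hτ) hb.closure

lemma size_le_maxSize (hb : Bornology.IsBounded Ω) {x : E d} (hx : x ∈ Ω) :
    T.size x ≤ T.maxSize := by
  refine le_csSup ⟨Metric.diam (closure Ω), ?_⟩ ⟨x, hx, rfl⟩
  rintro _ ⟨y, -, rfl⟩
  exact T.size_le_diam hb y

lemma maxSize_le_diam (hb : Bornology.IsBounded Ω) : T.maxSize ≤ Metric.diam (closure Ω) := by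
  refine Real.sSup_le ?_ Metric.diam_nonneg
  rintro _ ⟨y, -, rfl⟩
  exact T.size_le_diam hb y

lemma maxSize_pos (hd : 0 < d) (hb : Bornology.IsBounded Ω) (hne : Ω.Nonempty) : 0 < T.maxSize := by
  obtain ⟨x, hx⟩ := hne
  exact (T.size_pos hd hx).trans_le (T.size_le_maxSize hb hx)

/-- The size depends only on which of the finitely many closed elements contain the point. -/
lemma measurable_size : Measurable T.size := by
  let F : E d → (T.elems → Prop) := fun x τ => x ∈ τ.1
  let S : (T.elems → Prop) → ℝ := fun P => sSup (Metric.diam '' {τ | ∃ h : τ ∈ T.elems, P ⟨τ, h⟩})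
  have hF : Measurable F := measurable_pi_iff.2 fun τ =>
    measurableSet_setOfPred.1 (T.isCompact τ.1 τ.2).measurableSet
  have hS : Measurable S := Measurable.of_discrete
  have : T.size = S ∘ F := by
    funext x
    simp only [Mesh.size, S, F, Function.comp_apply, exists_prop]
  rw [this]
  exact hS.comp hF

/-- The mesh-weighted norm controls the `H¹` norm. -/
lemma norm1_le_maxSize_mul (hd : 0 < d) (hb : Bornology.IsBounded Ω)
    (hne : Ω.Nonempty) (hU : IsOpen U) (hUΩ : U ⊆ Ω) {m : ℝ} (hm : 0 < m)
    (hmT : ∀ x ∈ Ω, m ≤ T.size x) (h : HasGrad U u p) :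
    norm1 U u ≤ T.maxSize * wnorm1 U (fun x => (T.size x)⁻¹) u := by
  have hpos := T.maxSize_pos hd hb hne
  refine (sq_le_sq₀ norm1_nonneg (mul_nonneg hpos.le (wnorm1_nonneg _))).1 ?_
  rw [mul_pow, h.norm1_sq hU, h.wnorm1_sq hU, ← integral_const_mul]
  -- The lower bound `m` is needed here: were the weighted integrand not integrable, its integral
  -- would be `0` by convention.
  have hint : IntegrableOn (fun x => (T.size x)⁻¹ ^ 2 * gradSq u p x) U := by
    refine h.integrable_gradSq.bdd_mul (c := m⁻¹ ^ 2)
      (T.measurable_size.inv.pow_const 2).aestronglyMeasurable ?_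
    filter_upwards [ae_restrict_mem hU.measurableSet] with x hx
    have h1 := hmT x (hUΩ hx)
    have h2 : 0 < T.size x := hm.trans_le h1
    rw [Real.norm_of_nonneg (by positivity)]
    gcongr
  refine setIntegral_mono_on h.integrable_gradSq (hint.const_mul _) hU.measurableSet fun x hx => ?_
  have h1 := T.size_le_maxSize hb (hUΩ hx)
  have h2 := T.size_pos hd (hUΩ hx)
  have h3 : 1 ≤ T.maxSize ^ 2 * (T.size x)⁻¹ ^ 2 := by
    rw [← mul_pow]
    refine one_le_pow₀ ?_
    rw [← div_eq_mul_inv]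
    exact (one_le_div h2).2 h1
  rw [← mul_assoc]
  exact le_mul_of_one_le_left (gradSq_nonneg _ _ _) h3

end Mesh

lemma wnorm0_sq_le (hU : IsOpen U) (hu : MemLp u 2 (volume.restrict U)) {ρ : E d → ℝ} {B : ℝ}
    (hρ : ∀ x ∈ U, |ρ x| ≤ B) : wnorm0 U ρ u ^ 2 ≤ B ^ 2 * norm0 U u ^ 2 := by
  unfold norm0 wnorm0
  rw [Real.sq_sqrt (by positivity), Real.sq_sqrt (by positivity), ← integral_const_mul]
  refine integral_mono_of_nonneg (Eventually.of_forall fun x => by positivity) ?_ ?_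
  · simpa using (hu.integrable_norm_pow (p := 2) (by norm_num)).const_mul (B ^ 2)
  · filter_upwards [ae_restrict_mem hU.measurableSet] with x hx
    have := sq_le_sq' (neg_le_of_abs_le (hρ x hx)) (le_of_abs_le (hρ x hx))
    simp only [one_pow, one_mul]
    gcongr

lemma norm0_mono (hU : U ⊆ D) (hu : MemLp u 2 (volume.restrict D)) :
    norm0 U u ≤ norm0 D u := by
  unfold norm0 wnorm0
  refine Real.sqrt_le_sqrt (setIntegral_mono_set ?_ (Eventually.of_forall fun x => by positivity)
    (Eventually.of_forall hU))
  simpa [IntegrableOn] using hu.integrable_norm_pow (p := 2) (by norm_num)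

/-- `w ∈ V_h(Ω)` vanishes on `∂Ω ∩ ∂Ω₀` and solves the discrete equations on `Ω₀` with right-hand
side `f`. -/
structure IsLocalSolution (L : Coeffs d) (Ω Ω₀ : Set (E d)) (V : Submodule ℂ (E d → ℂ))
    (f : (E d → ℂ) → ℂ) (w : E d → ℂ) : Prop where
  memHneg1 : MemHneg1 Ω f
  mem : w ∈ V
  vanish : ∀ x ∈ frontier Ω ∩ frontier Ω₀, w x = 0
  eq : ∀ v ∈ innerSpace Ω V Ω₀, L.form Ω₀ w v = f v

lemma eventually_eq_zero_of_notMem_suppIn (hΩ : IsOpen Ω) {x : E d} (hx : x ∈ Ω)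
    (hxs : x ∉ suppIn Ω v) : v =ᶠ[𝓝 x] 0 := by
  have h1 : x ∉ closure {x | x ∈ Ω ∧ v x ≠ 0} := fun h => hxs ⟨hx, h⟩
  filter_upwards [isClosed_closure.isOpen_compl.mem_nhds h1, hΩ.mem_nhds hx] with y hy hyΩ
  by_contra h
  exact hy (subset_closure ⟨hyΩ, h⟩)

/-- Here `X` is the energy of `η w`, `Y` and `Z` are the squared `L²` and `H¹` norms of `w`, `R` is
the squared approximation error, `n` the norm of `v` and `F` that of `f`. The product `F n` is split
with a weight that leaves exactly `X / 2` to absorb; `R ≤ C h² Z` makes `h⁻¹ R` of order `h Z`, and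
`H` reduces `h²` to order `h`. -/
lemma young_absorb {X Y Z F n R h H C₁ C₂ C₃ : ℝ} (hh : 0 < h) (hH : h ≤ H) (hC₁ : 0 < C₁)
    (hC₃ : 1 ≤ C₃) (hY : 0 ≤ Y) (hZ : 0 ≤ Z)
    (hX : X ≤ C₁ * (Y + h * Z + h⁻¹ * R + F * n))
    (hn : n ^ 2 ≤ 2 * (C₃ * X) + 2 * R) (hR : R ≤ h ^ 2 * (C₂ ^ 2 * Z)) :
    X ≤ (2 * C₁ + 2 * C₁ * (1 + C₂ ^ 2) + 2 * H * C₂ ^ 2 + 2 * C₁ ^ 2 * C₃) *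
      (h * Z + Y + F ^ 2) := by
  have hC₃0 : 0 < C₃ := by linarith
  have h1 : C₁ * (F * n) ≤ n ^ 2 / (4 * C₃) + C₁ ^ 2 * C₃ * F ^ 2 := by
    have h2 : 0 ≤ C₃ * (n / (2 * C₃) - C₁ * F) ^ 2 := by positivity
    have h3 : C₃ * (n / (2 * C₃) - C₁ * F) ^ 2 =
        n ^ 2 / (4 * C₃) - C₁ * (F * n) + C₁ ^ 2 * C₃ * F ^ 2 := by field_simp; ring
    linarith
  have h4 : n ^ 2 / (4 * C₃) ≤ X / 2 + h * H * (C₂ ^ 2 * Z) := by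
    rw [div_le_iff₀ (by positivity)]
    have h5 : h ^ 2 * (C₂ ^ 2 * Z) ≤ h * H * (C₂ ^ 2 * Z) := by
      rw [pow_two]; gcongr
    have h6 : 0 ≤ h * H * (C₂ ^ 2 * Z) := by
      have : 0 ≤ H := hh.le.trans hH
      positivity
    nlinarith [mul_nonneg (sub_nonneg.2 hC₃) h6]
  have h7 : h⁻¹ * R ≤ h * (C₂ ^ 2 * Z) := by
    rw [inv_mul_le_iff₀ hh]
    linarith
  have h8 : C₁ * (h⁻¹ * R) ≤ C₁ * (h * (C₂ ^ 2 * Z)) := by gcongr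
  have hH0 : 0 ≤ H := hh.le.trans hH
  have n1 : 0 ≤ h * Z := by positivity
  have n2 : 0 ≤ C₁ * (1 + C₂ ^ 2) * (Y + F ^ 2) := by positivity
  have n3 : 0 ≤ H * C₂ ^ 2 * (Y + F ^ 2) := by positivity
  have n4 : 0 ≤ C₁ ^ 2 * C₃ * (h * Z + Y) := by positivity
  have n5 : 0 ≤ C₁ * (h * Z + F ^ 2) := by positivity
  nlinarith

/-! ### The interior estimate and its iteration. -/

section Interior

variable {L : Coeffs d} {a₀ : ℝ} {ι : Type*} {T : ι → Mesh Ω} {V : ι → Submodule ℂ (E d → ℂ)} {ε : ℝ}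

/-- One step of the interior estimate: from `Ω ∩ thickening s' G` to `Ω ∩ thickening s G` one gains
a factor `h` in the energy. -/
lemma interior_estimate_step (hd : 0 < d) (hΩ : IsOpen Ω) (hb : Bornology.IsBounded Ω)
    (hne : Ω.Nonempty) (hL : L.Admissible Ω a₀)
    (hV : ∀ k, IsFESpace (T k) (V k)) (hΩ₀ : IsOpen Ω₀) (hΩ₀Ω : Ω₀ ⊆ Ω)
    (hε : Ω ∩ Metric.thickening ε G ⊆ Ω₀) (hgr : MeshGrading T) (hA3 : Superapproximation T V Ω₀)
    {s s' : ℝ} (hs : 0 < s) (hss' : s < s') (hs' : s' < ε) :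
    ∃ C > 0, ∀ k f w, IsLocalSolution L Ω Ω₀ (V k) f w →
      norm1 (Ω ∩ Metric.thickening s G) w ^ 2 ≤
        C * ((T k).maxSize * norm1 (Ω ∩ Metric.thickening s' G) w ^ 2 + norm0 Ω₀ w ^ 2
          + normNeg1 Ω₀ f ^ 2) := by
  set D := Ω ∩ Metric.thickening s' G
  have hs'0 : 0 < s' := hs.trans hss'
  have hDo : IsOpen D := isOpen_inter_thickening hΩ s'
  have hDΩ₀ : D ⊆ Ω₀ :=
    (inter_subset_inter_right _ (Metric.thickening_mono hs'.le G)).trans hε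
  have hDΩ : D ⊆ Ω := inter_subset_left
  -- `η` drops from `1` to `0` between radii `s` and `b < s'`, so its support is well inside `D`. A
  -- second cut-off `χ`, equal to `1` on `D` and dropping between `s'` and `b' < ε`, serves to show
  -- that `v` is in `H¹₀(Ω₀)`.
  obtain ⟨b, hsb, hbs'⟩ := exists_between hss'
  obtain ⟨b', hs'b', hb'ε⟩ := exists_between hs'
  have hb0 : 0 < b := hs.trans hsb
  have hb'0 : 0 < b' := hs'0.trans hs'b'
  obtain ⟨η, K, hη, hη1, hη0⟩ := exists_isCutoff hb G hb0 hsb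
  obtain ⟨χ, K', hχ, hχ1, hχ0⟩ := exists_isCutoff hb G hb'0 hs'b'
  have hcth : Ω ∩ Metric.cthickening b G ⊆ D :=
    inter_subset_inter_right _ (Metric.cthickening_subset_thickening' hs'0 hbs' G)
  have hηD : ∀ x ∈ Ω, x ∉ D → η =ᶠ[𝓝 x] 0 := by
    intro x hx hxD
    have h1 : x ∉ Metric.cthickening b G := fun h => hxD (hcth ⟨hx, h⟩)
    filter_upwards [Metric.isClosed_cthickening.isOpen_compl.mem_nhds h1] with y hy
    exact hη0 y fun h => hy (Metric.thickening_subset_cthickening _ _ h)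
  obtain ⟨C₁, hC₁, henergy⟩ := hL.local_energy hΩ hΩ₀ hDo hDΩ₀ hΩ₀Ω hη hηD
  have hsupp : suppIn Ω (fun x => η x ^ 2) ⊆ Ω ∩ Metric.cthickening b G := by
    refine inter_subset_inter_right _ (closure_minimal (fun x hx => ?_) Metric.isClosed_cthickening)
    by_contra h
    exact hx.2 (by simp [hη0 x fun h' => h (Metric.thickening_subset_cthickening _ _ h')])
  obtain ⟨C₂, -, happrox⟩ := hA3 D hDo hDΩ₀ (fun x => η x ^ 2) (hη.contDiff.pow 2)
    (wellInside_of_subset_cthickening hΩ hDo hb0.le hbs' (hsupp.trans inter_subset_right)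
      (hsupp.trans hcth) hDΩ subset_rfl)
  set H := Metric.diam (closure Ω)
  have hH0 : 0 ≤ H := Metric.diam_nonneg
  set C₃ : ℝ := 1 + d * (1 + K) ^ 2 with hC₃
  have hC₃1 : 1 ≤ C₃ := by rw [hC₃]; linarith [show (0 : ℝ) ≤ d * (1 + K) ^ 2 by positivity]
  refine ⟨2 * C₁ + 2 * C₁ * (1 + C₂ ^ 2) + 2 * H * C₂ ^ 2 + 2 * C₁ ^ 2 * C₃, by positivity,
    fun k f w hw => ?_⟩
  have hh := (T k).maxSize_pos hd hb hne
  set h := (T k).maxSize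
  have hwg := (hV k).hasGrad hΩ hb hw.mem
  -- The boundary condition passes from `Ω₀` to `D`: a point of `∂Ω` in the closure of `D` lies on
  -- `∂Ω₀`, because `Ω₀ ⊆ Ω` is open.
  obtain ⟨v, ⟨hvV, hv10, hvD⟩, hvw⟩ := happrox k w ⟨w, hw.mem, fun _ _ => rfl⟩ (by
    rintro x ⟨hxD, hxΩ⟩
    refine hw.vanish x ⟨hxΩ, ?_⟩
    rw [hΩ.frontier_eq] at hxΩ
    rw [hΩ₀.frontier_eq]
    exact ⟨closure_mono hDΩ₀ hxD.1, fun h => hxΩ.2 (hΩ₀Ω h)⟩)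
  have hvg := (hV k).hasGrad hΩ hb hvV
  have hvev : ∀ x ∈ Ω, x ∉ D → v =ᶠ[𝓝 x] 0 := fun x hx hxD =>
    eventually_eq_zero_of_notMem_suppIn hΩ hx fun h => hxD (hvD.1 h)
  have hv0 : ∀ x ∈ Ω, x ∉ D → v x = 0 ∧ ∀ i, partialDeriv i v x = 0 := fun x hx hxD =>
    ⟨(hvev x hx hxD).eq_of_nhds, fun i => by
      unfold partialDeriv
      rw [(hvev x hx hxD).fderiv_eq]
      simp⟩
  have hvin : v ∈ innerSpace Ω (V k) Ω₀ := by
    refine ⟨hvV, hv10, wellInside_of_subset_cthickening (G := G) hΩ hΩ₀ hs'0.le hs' ?_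
      (hvD.1.trans hDΩ₀) hΩ₀Ω hε⟩
    exact hvD.1.trans (inter_subset_right.trans (Metric.thickening_subset_cthickening _ _))
  have hvH10 : MemH10 Ω₀ v := by
    refine hv10.of_cutoff hΩ₀ hΩ hΩ₀Ω hχ ?_ fun x hx => ?_
    · refine (inter_subset_inter_right _ ?_).trans hε
      have h1 : tsupport χ ⊆ Metric.cthickening b' G := by
        refine closure_minimal (fun x hx => ?_) Metric.isClosed_cthickening
        by_contra h
        exact hx (hχ0 x fun h' => h (Metric.thickening_subset_cthickening _ _ h'))
      exact h1.trans (Metric.cthickening_subset_thickening' (hb'0.trans hb'ε) hb'ε G)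
    · by_cases hxD : x ∈ D
      · rw [hχ1 x (Metric.thickening_subset_cthickening _ _ hxD.2)]
        simp
      · simp [(hv0 x (hΩ₀Ω hx) hxD).1]
  have hf := hw.memHneg1.norm_le hΩ₀ hΩ hΩ₀Ω hvH10 fun x hx hxΩ₀ =>
    (hv0 x hx fun h => hxΩ₀ (hDΩ₀ h)).1
  -- The Young parameter is `t = h`, which balances `t ‖w‖₁²` with `t⁻¹ ‖η²w - v‖₁²`, the latter
  -- being of order `t⁻¹ h² ‖w‖₁²`.
  have henergy' := henergy w v _ _ hwg hvg hv0 h hh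
  rw [hw.eq v hvin] at henergy'
  set u : E d → ℂ := fun x => (η x : ℂ) * w x with hu
  set z : E d → ℂ := fun x => (η x : ℂ) * u x with hz
  have hzv : (fun x => (η x : ℂ) * ((η x : ℂ) * w x) - v x) = z - v := rfl
  rw [hzv] at henergy'
  have hug := hwg.ofReal_mul hΩ subset_rfl hη
  have hzg := hug.ofReal_mul hΩ subset_rfl hη
  have hrg := (hzg.sub hvg).mono hDΩ
  have hzr : (fun x => ((η x ^ 2 : ℝ) : ℂ) * w x - v x) = z - v := by
    funext x
    simp only [hz, hu, Pi.sub_apply, Complex.ofReal_pow]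
    ring
  rw [hzr] at hvw
  have hR : norm1 D (z - v) ^ 2 ≤ h ^ 2 * (C₂ ^ 2 * norm1 D w ^ 2) := by
    -- The grading enters this step only as a positive lower bound for the mesh size of the given
    -- mesh; it does not affect the constant.
    obtain ⟨ν, hν, Cg, hCg, hgrad⟩ := hgr
    have hm : 0 < h ^ ν / Cg := by positivity
    have h1 := (T k).norm1_le_maxSize_mul hd hb hne hDo hDΩ hm
      (fun x hx => (div_le_iff₀' hCg).2 (hgrad k x hx)) hrg
    have h2 : norm1 D (z - v) ≤ h * (C₂ * norm1 D w) :=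
      h1.trans (mul_le_mul_of_nonneg_left hvw hh.le)
    calc norm1 D (z - v) ^ 2 ≤ (h * (C₂ * norm1 D w)) ^ 2 :=
          pow_le_pow_left₀ norm1_nonneg h2 2
      _ = _ := by ring
  have hnv : norm1 Ω₀ v ^ 2 ≤ 2 * (C₃ * norm1 D u ^ 2) + 2 * norm1 D (z - v) ^ 2 := by
    have h1 : norm1 Ω₀ v ^ 2 = ∫ x in D, gradSq v (fun i => partialDeriv i v) x := by
      rw [(hvg.mono hΩ₀Ω).norm1_sq hΩ₀,
        setIntegral_eq_of_subset_of_forall_sdiff_eq_zero hΩ₀.measurableSet hDΩ₀]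
      intro x hx
      simp [gradSq, hv0 x (hΩ₀Ω hx.1) hx.2]
    have h2 := (hug.mono hDΩ).norm1_mul_le hDo hDΩ hη
    have h3 : norm1 Ω₀ v ^ 2 ≤ 2 * norm1 D z ^ 2 + 2 * norm1 D (z - v) ^ 2 := by
      rw [h1, (hzg.mono hDΩ).norm1_sq hDo, hrg.norm1_sq hDo, ← integral_const_mul,
        ← integral_const_mul, ← integral_add ((hzg.mono hDΩ).integrable_gradSq.const_mul _)
          (hrg.integrable_gradSq.const_mul _)]
      refine setIntegral_mono_on (hvg.mono hDΩ).integrable_gradSq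
        (((hzg.mono hDΩ).integrable_gradSq.const_mul _).add
          (hrg.integrable_gradSq.const_mul _)) hDo.measurableSet fun x _ => ?_
      have h4 := gradSq_sub_le z (z - v) (mulGrad η u (mulGrad η w fun i => partialDeriv i w))
        (mulGrad η u (mulGrad η w fun i => partialDeriv i w) - fun i => partialDeriv i v) x
      simpa only [sub_sub_cancel] using h4
    linarith
  have hYle : norm0 D w ^ 2 ≤ norm0 Ω₀ w ^ 2 :=
    pow_le_pow_left₀ (Real.sqrt_nonneg _) (norm0_mono hDΩ₀ (hwg.mono hΩ₀Ω).memLp) 2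
  have hXle : norm1 (Ω ∩ Metric.thickening s G) w ^ 2 ≤ norm1 D u ^ 2 := by
    have hsD : Ω ∩ Metric.thickening s G ⊆ D :=
      inter_subset_inter_right _ (Metric.thickening_mono hss'.le G)
    have h1 : norm1 (Ω ∩ Metric.thickening s G) w = norm1 (Ω ∩ Metric.thickening s G) u := by
      refine norm1_congr ?_
      filter_upwards [ae_restrict_mem (isOpen_inter_thickening hΩ s).measurableSet] with x hx
      simp [hu, hη1 x (Metric.thickening_subset_cthickening _ _ hx.2)]
    rw [h1]
    exact pow_le_pow_left₀ norm1_nonneg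
      ((hug.mono hDΩ).norm1_mono (isOpen_inter_thickening hΩ s) hDo hsD) 2
  refine hXle.trans (young_absorb (n := norm1 Ω₀ v) hh ((T k).maxSize_le_diam hb) hC₁ hC₃1
    (sq_nonneg _) (sq_nonneg _) (henergy'.trans ?_) hnv hR)
  gcongr

/-- Each step costs a slightly larger radius, still below `ε`, and gains a factor `h`. The
lower-order terms collect factors of `h`, bounded by the diameter of `Ω`, so the constant depends on
`n` and the radii but not on the mesh. -/
lemma interior_estimate_pow (hd : 0 < d) (hΩ : IsOpen Ω) (hb : Bornology.IsBounded Ω)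
    (hne : Ω.Nonempty) (hL : L.Admissible Ω a₀)
    (hV : ∀ k, IsFESpace (T k) (V k)) (hΩ₀ : IsOpen Ω₀) (hΩ₀Ω : Ω₀ ⊆ Ω)
    (hε : Ω ∩ Metric.thickening ε G ⊆ Ω₀) (hgr : MeshGrading T) (hA3 : Superapproximation T V Ω₀)
    (n : ℕ) {s : ℝ} (hs : 0 < s) (hsε : s < ε) :
    ∃ C > 0, ∀ k f w, IsLocalSolution L Ω Ω₀ (V k) f w →
      norm1 (Ω ∩ Metric.thickening s G) w ^ 2 ≤
        C * ((T k).maxSize ^ n * norm1 Ω₀ w ^ 2 + norm0 Ω₀ w ^ 2 + normNeg1 Ω₀ f ^ 2) := by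
  induction n generalizing s with
  | zero =>
    refine ⟨1, one_pos, fun k f w hw => ?_⟩
    have hsub : Ω ∩ Metric.thickening s G ⊆ Ω₀ :=
      (inter_subset_inter_right _ (Metric.thickening_mono hsε.le G)).trans hε
    have h1 := (((hV k).hasGrad hΩ hb hw.mem).mono hΩ₀Ω).norm1_mono
      (isOpen_inter_thickening hΩ s) hΩ₀ hsub
    have h2 := pow_le_pow_left₀ norm1_nonneg h1 2
    have h3 : 0 ≤ norm0 Ω₀ w ^ 2 := sq_nonneg _
    have h4 : 0 ≤ normNeg1 Ω₀ f ^ 2 := sq_nonneg _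
    simp only [pow_zero, one_mul]
    linarith
  | succ n ih =>
    obtain ⟨s', hss', hs'ε⟩ := exists_between hsε
    obtain ⟨C, hC, hstep⟩ := interior_estimate_step hd hΩ hb hne hL hV hΩ₀ hΩ₀Ω hε hgr hA3 hs hss' hs'ε
    obtain ⟨C', hC', hih⟩ := ih (hs.trans hss') hs'ε
    set H := Metric.diam (closure Ω)
    have hH0 : 0 ≤ H := Metric.diam_nonneg
    refine ⟨C * (C' + H * C' + 1), by positivity, fun k f w hw => ?_⟩
    have hh := (T k).maxSize_pos hd hb hne
    have hhH := (T k).maxSize_le_diam hb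
    set h := (T k).maxSize
    set Y := norm0 Ω₀ w ^ 2 + normNeg1 Ω₀ f ^ 2
    have hY : 0 ≤ Y := by positivity
    set Z := norm1 Ω₀ w ^ 2
    have hZ : 0 ≤ h ^ (n + 1) * Z := by positivity
    have h1 := hstep k f w hw
    have h2 := hih k f w hw
    rw [add_assoc] at h1 h2 ⊢
    calc _ ≤ C * (h * (C' * (h ^ n * Z + Y)) + Y) := by
          refine h1.trans ?_
          gcongr
      _ = C * (C' * (h ^ (n + 1) * Z) + (h * C' + 1) * Y) := by ring
      _ ≤ C * (C' * (h ^ (n + 1) * Z) + (H * C' + 1) * Y) := by gcongr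
      _ ≤ C * ((C' + H * C' + 1) * (h ^ (n + 1) * Z) + (C' + H * C' + 1) * Y) := by
          gcongr
          · nlinarith [mul_nonneg hH0 hC'.le]
          · linarith
      _ = _ := by ring

/-- The remaining `hⁿ ‖w‖₁²` is traded for `‖w‖₀²`: by the inverse estimate and the grading, `h^{2ν}
‖w‖₁²` is at most a constant times `‖w‖₀²`. -/
lemma interior_estimate (hd : 0 < d) (hΩ : IsOpen Ω) (hb : Bornology.IsBounded Ω)
    (hne : Ω.Nonempty) (hL : L.Admissible Ω a₀)
    (hV : ∀ k, IsFESpace (T k) (V k)) (hG : IsOpen G) (hGΩ₀ : G ⊆ Ω₀) (hΩ₀ : IsOpen Ω₀)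
    (hΩ₀Ω : Ω₀ ⊆ Ω) (hε0 : 0 < ε)
    (hε : Ω ∩ Metric.thickening ε G ⊆ Ω₀) (hgr : MeshGrading T) (hinv : InverseEstimate T V Ω₀)
    (hA3 : Superapproximation T V Ω₀) :
    ∃ C > 0, ∀ k f w, IsLocalSolution L Ω Ω₀ (V k) f w →
      norm1 G w ≤ C * (norm0 Ω₀ w + normNeg1 Ω₀ f) := by
  obtain ⟨s, hs, hsε⟩ := exists_between hε0
  have hgr' := hgr
  obtain ⟨ν, hν, Cg, hCg, hgrad⟩ := hgr'
  obtain ⟨Ci, hCi, hinv⟩ := hinv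
  -- With `n ≥ 2ν` the surplus power `h^(n - 2ν)` is bounded by the same power of the diameter of
  -- `Ω`.
  obtain ⟨n, hn⟩ := exists_nat_ge (2 * ν)
  obtain ⟨C, hC, hest⟩ := interior_estimate_pow hd hΩ hb hne hL hV hΩ₀ hΩ₀Ω hε hgr hA3 n hs hsε
  set H := Metric.diam (closure Ω)
  have hH0 : 0 ≤ H := Metric.diam_nonneg
  set B : ℝ := C * (H ^ ((n : ℝ) - 2 * ν) * (Ci ^ 2 * Cg ^ 2) + 1) with hB
  have hB0 : 0 < B := by positivity
  refine ⟨√B, Real.sqrt_pos.2 hB0, fun k f w hw => ?_⟩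
  have hh := (T k).maxSize_pos hd hb hne
  have hhH := (T k).maxSize_le_diam hb
  have h1 := hest k f w hw
  set h := (T k).maxSize
  have hwg := ((hV k).hasGrad hΩ hb hw.mem).mono hΩ₀Ω
  have hhν : 0 < h ^ ν := Real.rpow_pos_of_pos hh ν
  have h2 : (h ^ ν) ^ 2 * norm1 Ω₀ w ^ 2 ≤ Ci ^ 2 * Cg ^ 2 * norm0 Ω₀ w ^ 2 := by
    have h3 : norm1 Ω₀ w ^ 2 ≤ (Ci * wnorm0 Ω₀ (fun x => ((T k).size x)⁻¹) w) ^ 2 :=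
      pow_le_pow_left₀ norm1_nonneg (hinv k w ⟨w, hw.mem, fun _ _ => rfl⟩) 2
    have h4 : wnorm0 Ω₀ (fun x => ((T k).size x)⁻¹) w ^ 2 ≤ (Cg / h ^ ν) ^ 2 * norm0 Ω₀ w ^ 2 := by
      refine wnorm0_sq_le hΩ₀ hwg.memLp fun x hx => ?_
      have h5 := (T k).size_pos hd (hΩ₀Ω hx)
      rw [abs_of_pos (inv_pos.2 h5), le_div_iff₀ hhν, inv_mul_le_iff₀ h5, mul_comm]
      exact hgrad k x (hΩ₀Ω hx)
    calc (h ^ ν) ^ 2 * norm1 Ω₀ w ^ 2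
        ≤ (h ^ ν) ^ 2 * (Ci ^ 2 * ((Cg / h ^ ν) ^ 2 * norm0 Ω₀ w ^ 2)) := by
          rw [mul_pow] at h3
          gcongr
          refine h3.trans ?_
          gcongr
      _ = _ := by field_simp
  have h6 : h ^ n * norm1 Ω₀ w ^ 2 ≤
      H ^ ((n : ℝ) - 2 * ν) * (Ci ^ 2 * Cg ^ 2) * norm0 Ω₀ w ^ 2 := by
    have h7 : h ^ n = h ^ ((n : ℝ) - 2 * ν) * (h ^ ν) ^ 2 := by
      rw [← Real.rpow_natCast, ← Real.rpow_natCast (h ^ ν), ← Real.rpow_mul hh.le,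
        ← Real.rpow_add hh]
      congr 1
      push_cast
      ring
    rw [h7, mul_assoc, mul_assoc (H ^ _)]
    have h8 : h ^ ((n : ℝ) - 2 * ν) ≤ H ^ ((n : ℝ) - 2 * ν) :=
      Real.rpow_le_rpow hh.le hhH (sub_nonneg.2 hn)
    gcongr
  have hwG : norm1 G w ^ 2 ≤ norm1 (Ω ∩ Metric.thickening s G) w ^ 2 :=
    pow_le_pow_left₀ norm1_nonneg
      ((((hV k).hasGrad hΩ hb hw.mem).mono inter_subset_left).norm1_mono hG
        (isOpen_inter_thickening hΩ s)
        (subset_inter (hGΩ₀.trans hΩ₀Ω) (Metric.self_subset_thickening hs G))) 2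
  have hn0 : 0 ≤ norm0 Ω₀ w := Real.sqrt_nonneg _
  have hF0 := normNeg1_nonneg (U := Ω₀) f
  refine (sq_le_sq₀ norm1_nonneg (by positivity)).1 (hwG.trans (h1.trans ?_))
  rw [mul_pow, Real.sq_sqrt hB0.le, hB, mul_assoc]
  refine mul_le_mul_of_nonneg_left ?_ hC.le
  set Q := H ^ ((n : ℝ) - 2 * ν) * (Ci ^ 2 * Cg ^ 2)
  have hQ : 0 ≤ Q := by positivity
  have e1 : 0 ≤ norm0 Ω₀ w * normNeg1 Ω₀ f := mul_nonneg hn0 hF0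
  have e2 : 0 ≤ Q * (2 * (norm0 Ω₀ w * normNeg1 Ω₀ f) + normNeg1 Ω₀ f ^ 2) := by positivity
  nlinarith

end Interior

end FiniteElements

end LocalFEM

end


/-! ### The theorem. -/

open LocalFEM
theorem lemma2p3 {d : ℕ} (hd : 2 ≤ d) {Ω : Set (E d)} (hΩ : IsPolyhedralDomain Ω)
    (L : Coeffs d) (a₀ : ℝ) (hL : L.Admissible Ω a₀)
    {ι : Type*} (T : ι → Mesh Ω) (V : ι → Submodule ℂ (E d → ℂ))
    (hV : ∀ k, IsFESpace (T k) (V k))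
    (G Ω₀ : Set (E d)) (hG : IsOpen G) (hΩ₀ : IsOpen Ω₀) (hGΩ₀ : WellInside Ω G Ω₀)
    (hA0 : MeshGrading T) (hA2 : InverseEstimate T V Ω₀) (hA3 : Superapproximation T V Ω₀) :
    ∃ C : ℝ, 0 < C ∧ ∀ (k : ι) (f : (E d → ℂ) → ℂ), MemHneg1 Ω f →
      ∀ w ∈ restr (V k) Ω₀, (∀ x ∈ frontier Ω ∩ frontier Ω₀, w x = 0) →
        (∀ v ∈ innerSpace Ω (V k) Ω₀, L.form Ω₀ w v = f v) →
          norm1 G w ≤ C * (norm0 Ω₀ w + normNeg1 Ω₀ f) := by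
  obtain ⟨ε, hε0, hε⟩ := hGΩ₀.exists_thickening_subset hΩ
  obtain ⟨C, hC, hest⟩ := interior_estimate (by omega) hΩ.isOpen hΩ.isBounded hΩ.1.nonempty hL hV hG
    hGΩ₀.1 hΩ₀ hGΩ₀.2.1 hε0 hε hA0 hA2 hA3
  refine ⟨C, hC, fun k f hf w ⟨W, hW, hwW⟩ hw0 hwf => ?_⟩
  -- `w` is known only on the closure of `Ω₀`, whereas the estimates need a function with a gradient
  -- on `Ω`. The representative `W` agrees with `w` there, and the norms and the form see only
  -- almost everywhere classes on `Ω₀`.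
  have hae : w =ᵐ[volume.restrict Ω₀] W := by
    filter_upwards [ae_restrict_mem hΩ₀.measurableSet] with x hx using hwW (subset_closure hx)
  have := hest k f W ⟨hf, hW, fun x hx => by rw [← hwW hx.2.1, hw0 x hx], fun v hv => by
    rw [← L.form_congr_left hae, hwf v hv]⟩
  rwa [← norm1_congr (ae_restrict_of_subset hae hGΩ₀.1),
    ← show norm0 Ω₀ w = norm0 Ω₀ W from wnorm0_congr _ hae] at this
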